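/- Let $r\ge 3$ and $1\le q<r-1$ be integers and let $d_0,\dots,d_q$ be natural numbers. Let $\mathbf S_e$ be the space of homogeneous polynomials of degree $e$ in $\mathbb C[x_0,\dots,x_r]$, let $R=\sum_i x_i\,\partial/\partial x_i$ be the radial vector field on $\mathbb C^{r+1}$, and let $H=\mathrm H^0(\mathbb P^r,\Omega^q(\sum_i d_i))$, that is, the space of homogeneous polynomial $q$-forms $\omega$ on $\mathbb C^{r+1}$ with coefficients of degree $\sum_i d_i-q$ and $i_R\omega=0$. Consider the rational map $$\rho:\mathbb P(\mathbf S_{d_0})\times\cdots\times\mathbb P(\mathbf S_{d_q})\dashrightarrow\mathbb P(H),\qquad (F_0,\dots,F_q)\mapsto i_R(dF_0\wedge\cdots\wedge dF_q),$$ which is defined where the right-hand side is non-zero, and let $\mathscr R(r,d_0,\dots,d_q)$ be the Zariski closure of its image. Let $\mathcal U$ be the set of $\omega\in\mathscr R(r,d_0,\dots,d_q)$ such that the zero set of $d\omega$ has codimension at least $3$ and the zero set of $\omega$ has codimension at least $2$. Let $d=\sum_i d_i-q-1$, and let $\mathscr F=\mathscr F_q(r,d)$ be the scheme of codimension $q$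 foliations of degree $d$ on $\mathbb P^r$: the locally closed subscheme of $\mathbb P(H)$ defined by the equations $$(i_v\omega)\wedge\omega=0,\qquad (i_v\omega)\wedge d\omega=0\qquad\text{for all }v\in\textstyle\bigwedge^{q-1}\mathbb C^{r+1}$$ in the open set where the zero set of $\omega$ has codimension at least $2$. Its Zariski tangent space $T_\omega\mathscr F\subset T_\omega\mathbb P(H)=H/(\omega)$ consists of the classes of the $\omega'\in H$ such that $\omega+\epsilon\omega'$ satisfies these equations modulo $\epsilon^2$. If $F_i\in\mathbf S_{d_i}$ $(0\le i\le q)$ are such that $\rho(F_0,\dots,F_q)=\omega$ is defined and lies in $\mathcal U$, then the derivative of $\rho$ at $F=(F_0,\dots,F_q)$ takes values in $T_\omega\mathscr F$, and $$d\rho(F):T_F\bigl(\mathbb P(\mathbf S_{d_0})\times\cdots\times\mathbb P(\mathbf S_{d_q})\bigr)=\prod_{i}\mathbf S_{d_i}/(F_i)\longrightarrow T_\omega\mathscr F$$ is surjective. -/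

import Mathlib

open scoped TensorProduct LinearAlgebra.Projectivization

noncomputable section

namespace RationalFoliation

/-! Throughout `x_0, …, x_r` are the coordinates of `ℂ^{r+1} = (Fin (r + 1) → ℂ)`. -/

/-! ### Polynomial differential forms on `ℂ^{r+1}` -/

/-- The polynomial ring `ℂ[x_0, …, x_r]`. -/
abbrev Poly (r : ℕ) : Type := MvPolynomial (Fin (r + 1)) ℂ

/-- The vector space `ℂ^{r+1}`. -/
abbrev Vec (r : ℕ) : Type := Fin (r + 1) → ℂ

/-- The exterior algebra of the dual space of `ℂ^{r+1}`: differential forms with constant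
coefficients. -/
abbrev ConstForm (r : ℕ) : Type := ExteriorAlgebra ℂ (Module.Dual ℂ (Vec r))

/-- The algebra of polynomial differential forms on `ℂ^{r+1}`: sums of products `f α` of a
polynomial `f` and a constant form `α`. The product is the wedge product. -/
def Form (r : ℕ) : Type := Poly r ⊗[ℂ] ConstForm r

instance (r : ℕ) : Ring (Form r) := inferInstanceAs (Ring (Poly r ⊗[ℂ] ConstForm r))

instance (r : ℕ) : Algebra ℂ (Form r) := inferInstanceAs (Algebra ℂ (Poly r ⊗[ℂ] ConstForm r))

/-- `Form r` is the tensor product of the algebras of polynomials and of constant forms. -/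
def Form.equivTensor (r : ℕ) : Form r ≃ₐ[ℂ] Poly r ⊗[ℂ] ConstForm r := AlgEquiv.refl

/-- The form `f α`, for a polynomial `f` and a constant form `α`; it is bilinear. -/
def Form.mk {r : ℕ} : Poly r →ₗ[ℂ] ConstForm r →ₗ[ℂ] Form r :=
  (TensorProduct.mk ℂ (Poly r) (ConstForm r)).compr₂ (Form.equivTensor r).symm.toLinearMap

/-- The linear map with `f α ↦ (g f) (h α)`. -/
def Form.map {r : ℕ} (g : Poly r →ₗ[ℂ] Poly r) (h : ConstForm r →ₗ[ℂ] ConstForm r) :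
    Form r →ₗ[ℂ] Form r :=
  (Form.equivTensor r).symm.toLinearMap ∘ₗ TensorProduct.map g h ∘ₗ
    (Form.equivTensor r).toLinearMap

theorem Form.map_mk {r : ℕ} (g : Poly r →ₗ[ℂ] Poly r) (h : ConstForm r →ₗ[ℂ] ConstForm r)
    (f : Poly r) (α : ConstForm r) : Form.map g h (Form.mk f α) = Form.mk (g f) (h α) := by
  simp [Form.map, Form.mk]

theorem Form.mk_mul_mk {r : ℕ} (f f' : Poly r) (α α' : ConstForm r) :
    Form.mk f α * Form.mk f' α' = Form.mk (f * f') (α * α') := by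
  apply (Form.equivTensor r).injective
  simp [Form.mk]

theorem Form.mk_one_one (r : ℕ) : (Form.mk 1 1 : Form r) = 1 := by
  apply (Form.equivTensor r).injective
  simp [Form.mk, Algebra.TensorProduct.one_def]

@[elab_as_elim]
theorem Form.induction {r : ℕ} {C : Form r → Prop} (η : Form r) (zero : C 0)
    (mk : ∀ f α, C (Form.mk f α)) (add : ∀ a b, C a → C b → C (a + b)) : C η :=
  TensorProduct.induction_on (motive := fun x => C ((Form.equivTensor r).symm x))
    (Form.equivTensor r η) (by simpa using zero) mk
    (fun a b ha hb => by simpa using add _ _ ha hb)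

/-- The space `S_e` of homogeneous polynomials of degree `e` in `x_0, …, x_r`. -/
abbrev S (r e : ℕ) : Submodule ℂ (Poly r) := MvPolynomial.homogeneousSubmodule (Fin (r + 1)) ℂ e

/-- The constant `1`-form `dx_i`. -/
def dx {r : ℕ} (i : Fin (r + 1)) : ConstForm r :=
  ExteriorAlgebra.ι ℂ (LinearMap.proj i : Module.Dual ℂ (Vec r))

/-- Interior product of constant forms with a vector `v` of `ℂ^{r+1}`. -/
def contractVec {r : ℕ} : Vec r →ₗ[ℂ] ConstForm r →ₗ[ℂ] ConstForm r :=
  CliffordAlgebra.contractLeft ∘ₗ Module.Dual.eval ℂ (Vec r)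

/-- Interior product `i_v` of constant forms with a multivector `v`; it is the algebra map
determined by `v ↦ i_v` on vectors. -/
def contractMulti {r : ℕ} : ExteriorAlgebra ℂ (Vec r) →ₐ[ℂ] Module.End ℂ (ConstForm r) :=
  ExteriorAlgebra.lift ℂ ⟨contractVec, fun v => LinearMap.ext fun α =>
    CliffordAlgebra.contractLeft_contractLeft (Module.Dual.eval ℂ (Vec r) v) α⟩

/-- Interior product `i_v ω` of a polynomial form with a constant multivector `v`. -/
def interiorProd {r : ℕ} (v : ExteriorAlgebra ℂ (Vec r)) : Form r →ₗ[ℂ] Form r :=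
  Form.map LinearMap.id (contractMulti v)

/-- The exterior derivative `d(f α) = ∑ i, (∂f/∂x_i) dx_i ∧ α` (`α` a constant form). -/
def extD {r : ℕ} : Form r →ₗ[ℂ] Form r :=
  ∑ i : Fin (r + 1), Form.map (MvPolynomial.pderiv i).toLinearMap
    (LinearMap.mulLeft ℂ (dx i))

/-- The interior product `i_R` with the radial vector field `R = ∑ i, x_i ∂/∂x_i`. -/
def iR {r : ℕ} : Form r →ₗ[ℂ] Form r :=
  ∑ i : Fin (r + 1), Form.map (LinearMap.mulLeft ℂ (MvPolynomial.X i))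
    (contractVec (Pi.single i 1))

/-- The differential `dF` of a polynomial, as a linear function of `F`. -/
def dPoly {r : ℕ} : Poly r →ₗ[ℂ] Form r :=
  extD ∘ₗ Form.mk.flip 1

/-- The value of a form at the point `x`. -/
def evalAt {r : ℕ} (x : Vec r) : Form r →ₗ[ℂ] ConstForm r :=
  (TensorProduct.lid ℂ (ConstForm r)).toLinearMap ∘ₗ
    TensorProduct.map (MvPolynomial.aeval x : Poly r →ₐ[ℂ] ℂ).toLinearMap LinearMap.id ∘ₗ
      (Form.equivTensor r).toLinearMap

/-- The singular set of a form: its zero set in `ℂ^{r+1}`. For a homogeneous form with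
coefficients of positive degree it is the cone over the zero set in `ℙ^r`. -/
def sing {r : ℕ} (ω : Form r) : Set (Vec r) := {x | evalAt x ω = 0}

/-- The codimension of an algebraic subset of `ℂ^{r+1}`: the height of its vanishing ideal,
i.e. the least codimension of an irreducible component (`⊤` for the empty set). -/
def codim {r : ℕ} (Z : Set (Vec r)) : ℕ∞ := (MvPolynomial.vanishingIdeal ℂ Z).height

/-! ### Twisted forms on `ℙ^r` -/

/-- Homogeneous polynomial `q`-forms on `ℂ^{r+1}` of total degree `m`: the coefficients are
homogeneous of degree `m - q` (and there is only the zero form when `m < q`). -/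
def homForms (r q m : ℕ) : Submodule ℂ (Form r) :=
  Submodule.span ℂ {η | ∃ (e : ℕ) (f : Poly r) (α : ConstForm r), e + q = m ∧
    f ∈ S r e ∧ α ∈ ⋀[ℂ]^q (Module.Dual ℂ (Vec r)) ∧ η = Form.mk f α}

/-- The space `H⁰(ℙ^r, Ω^q(m))` of twisted `q`-forms on `ℙ^r`: homogeneous `q`-forms on
`ℂ^{r+1}` of total degree `m` that are annihilated by the radial vector field. -/
def twistedForms (r q m : ℕ) : Submodule ℂ (Form r) := homForms r q m ⊓ LinearMap.ker iR

/-! ### Helper facts: `i_R (dF_0 ∧ ⋯ ∧ dF_q)` is a twisted form -/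

theorem mk_mem_homForms {r e q m : ℕ} {f : Poly r} {α : ConstForm r} (h : e + q = m)
    (hf : f ∈ S r e) (hα : α ∈ ⋀[ℂ]^q (Module.Dual ℂ (Vec r))) :
    Form.mk f α ∈ homForms r q m :=
  Submodule.subset_span ⟨e, f, α, h, hf, hα, rfl⟩

theorem iR_iR {r : ℕ} (η : Form r) : iR (iR η) = 0 := by
  induction η using Form.induction with
  | zero => rw [map_zero, map_zero]
  | add a b ha hb => rw [map_add, map_add, ha, hb, add_zero]
  | mk f α =>
    have key : iR (iR (Form.mk f α)) = -iR (iR (Form.mk f α)) := by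
      simp only [iR, LinearMap.sum_apply, Form.map_mk, map_sum, LinearMap.mulLeft_apply]
      rw [← Finset.sum_neg_distrib]
      conv_rhs => enter [2, i]; rw [← Finset.sum_neg_distrib]
      rw [Finset.sum_comm]
      refine Finset.sum_congr rfl fun i _ => Finset.sum_congr rfl fun j _ => ?_
      rw [← map_neg, mul_left_comm]
      exact congrArg _ (CliffordAlgebra.contractLeft_comm _ _ _)
    have h2 : (2 : ℂ) • iR (iR (Form.mk f α)) = 0 := by
      rw [two_smul]
      exact eq_neg_iff_add_eq_zero.mp key
    exact (smul_eq_zero.mp h2).resolve_left two_ne_zero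

theorem contractVec_mem {r n : ℕ} (v : Vec r) {α : ConstForm r}
    (hα : α ∈ ⋀[ℂ]^(n + 1) (Module.Dual ℂ (Vec r))) :
    contractVec v α ∈ ⋀[ℂ]^n (Module.Dual ℂ (Vec r)) := by
  induction n generalizing α with
  | zero =>
    rw [ExteriorAlgebra.exteriorPower, zero_add, pow_one] at hα
    obtain ⟨φ, rfl⟩ := hα
    rw [ExteriorAlgebra.exteriorPower, pow_zero]
    refine Submodule.mem_one.mpr ⟨φ v, ?_⟩
    exact (CliffordAlgebra.contractLeft_ι (Q := (0 : QuadraticForm ℂ (Module.Dual ℂ (Vec r))))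
      (Module.Dual.eval ℂ (Vec r) v) φ).symm
  | succ n ih =>
    rw [ExteriorAlgebra.exteriorPower, pow_succ'] at hα
    refine Submodule.mul_induction_on hα ?_ ?_
    · rintro _ ⟨φ, rfl⟩ β hβ
      have h1 : contractVec v (ExteriorAlgebra.ι ℂ φ * β) =
          φ v • β - ExteriorAlgebra.ι ℂ φ * contractVec v β :=
        CliffordAlgebra.contractLeft_ι_mul
          (Q := (0 : QuadraticForm ℂ (Module.Dual ℂ (Vec r)))) (d := Module.Dual.eval ℂ (Vec r) v) φ β
      rw [h1]
      refine Submodule.sub_mem _ (Submodule.smul_mem _ _ hβ) ?_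
      rw [ExteriorAlgebra.exteriorPower, pow_succ']
      exact Submodule.mul_mem_mul ⟨φ, rfl⟩ (ih hβ)
    · intro a b ha hb
      rw [map_add]
      exact Submodule.add_mem _ ha hb

theorem iR_mem_homForms {r q m : ℕ} {η : Form r} (hη : η ∈ homForms r (q + 1) m) :
    iR η ∈ homForms r q m := by
  refine Submodule.span_induction ?_ (by simp) (fun a b _ _ ha hb => ?_) (fun c a _ ha => ?_) hη
  · rintro _ ⟨e, f, α, he, hf, hα, rfl⟩
    rw [iR, LinearMap.sum_apply]
    refine Submodule.sum_mem _ fun i _ => ?_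
    rw [Form.map_mk]
    refine mk_mem_homForms (e := 1 + e) (by omega) ?_ (contractVec_mem _ hα)
    exact (MvPolynomial.isHomogeneous_X ℂ i).mul hf
  · rw [map_add]; exact Submodule.add_mem _ ha hb
  · rw [map_smul]; exact Submodule.smul_mem _ _ ha

theorem one_mem_homForms (r : ℕ) : (1 : Form r) ∈ homForms r 0 0 :=
  Form.mk_one_one r ▸ mk_mem_homForms (e := 0) rfl (MvPolynomial.isHomogeneous_one _ _)
    (by rw [ExteriorAlgebra.exteriorPower, pow_zero]; exact Submodule.one_le.mp le_rfl)

theorem mul_mem_homForms {r q m q' m' : ℕ} {η θ : Form r} (hη : η ∈ homForms r q m)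
    (hθ : θ ∈ homForms r q' m') : η * θ ∈ homForms r (q + q') (m + m') := by
  have h : η * θ ∈ homForms r q m * homForms r q' m' := Submodule.mul_mem_mul hη hθ
  rw [homForms, homForms, Submodule.span_mul_span] at h
  refine Submodule.span_le.mpr ?_ h
  rintro _ ⟨_, ⟨e, f, α, he, hf, hα, rfl⟩, _, ⟨e', f', α', he', hf', hα', rfl⟩, rfl⟩
  simp only [Form.mk_mul_mk]
  refine mk_mem_homForms (e := e + e') (by omega) (MvPolynomial.IsHomogeneous.mul hf hf') ?_
  rw [ExteriorAlgebra.exteriorPower, pow_add]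
  exact Submodule.mul_mem_mul hα hα'

theorem dPoly_eq {r : ℕ} (F : Poly r) :
    dPoly F = ∑ i, Form.mk (MvPolynomial.pderiv i F) (dx i) := by
  simp [dPoly, extD, Form.map_mk]

theorem dPoly_mem {r e : ℕ} {F : Poly r} (hF : F ∈ S r e) : dPoly F ∈ homForms r 1 e := by
  rw [dPoly_eq]
  refine Submodule.sum_mem _ fun i _ => ?_
  rcases Nat.eq_zero_or_pos e with rfl | he
  · have : F = MvPolynomial.C (MvPolynomial.coeff 0 F) :=
      MvPolynomial.totalDegree_eq_zero_iff_eq_C.mp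
        (Nat.le_zero.mp (MvPolynomial.IsHomogeneous.totalDegree_le hF))
    rw [this, MvPolynomial.pderiv_C, map_zero, LinearMap.zero_apply]
    exact Submodule.zero_mem _
  · refine mk_mem_homForms (e := e - 1) (by omega) (MvPolynomial.IsHomogeneous.pderiv hF) ?_
    rw [ExteriorAlgebra.exteriorPower, pow_one]
    exact ⟨_, rfl⟩

theorem list_prod_mem_homForms {r : ℕ} : ∀ (n : ℕ) (d : Fin n → ℕ) (η : Fin n → Form r),
    (∀ i, η i ∈ homForms r 1 (d i)) → (List.ofFn η).prod ∈ homForms r n (∑ i, d i)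
  | 0, _, _, _ => by simpa using one_mem_homForms r
  | n + 1, d, η, h => by
    have key := mul_mem_homForms (h 0)
      (list_prod_mem_homForms n (fun i => d i.succ) (fun i => η i.succ) fun i => h i.succ)
    rw [List.ofFn_succ, List.prod_cons, Fin.sum_univ_succ]
    rwa [Nat.add_comm 1 n] at key

/-! ### Rational forms and the parametrization -/

/-- The multilinear map `(F_0, …, F_q) ↦ i_R (dF_0 ∧ ⋯ ∧ dF_q)`, with values in all forms. -/
def muForm (r q : ℕ) (d : Fin (q + 1) → ℕ) :
    MultilinearMap ℂ (fun i => S r (d i)) (Form r) :=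
  (iR (r := r)).compMultilinearMap
    ((MultilinearMap.mkPiAlgebraFin ℂ (q + 1) (Form r)).compLinearMap
      fun i => dPoly ∘ₗ (S r (d i)).subtype)

theorem muForm_mem (r q : ℕ) (d : Fin (q + 1) → ℕ) (F : ∀ i, S r (d i)) :
    muForm r q d F ∈ twistedForms r q (∑ i, d i) := by
  refine ⟨?_, iR_iR _⟩
  refine iR_mem_homForms (q := q) ?_
  exact list_prod_mem_homForms (q + 1) d (fun i => dPoly (F i : Poly r))
    fun i => dPoly_mem (F i).2

/-- The multilinear map `μ (F_0, …, F_q) = i_R (dF_0 ∧ ⋯ ∧ dF_q)` from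
`S_{d_0} × ⋯ × S_{d_q}` to `H⁰(ℙ^r, Ω^q(d_0 + ⋯ + d_q))`. -/
def mu (r q : ℕ) (d : Fin (q + 1) → ℕ) :
    MultilinearMap ℂ (fun i => S r (d i)) (twistedForms r q (∑ i, d i)) :=
  (muForm r q d).codRestrict _ (muForm_mem r q d)

/-- The point `ρ(F) = [i_R (dF_0 ∧ ⋯ ∧ dF_q)]` of `ℙ(H⁰(ℙ^r, Ω^q(d_0 + ⋯ + d_q)))`, for `F`
outside the base locus. -/
def rho (r q : ℕ) (d : Fin (q + 1) → ℕ) (F : ∀ i, S r (d i)) (hF : mu r q d F ≠ 0) :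
    ℙ ℂ (twistedForms r q (∑ i, d i)) :=
  Projectivization.mk ℂ (mu r q d F) hF

/-- The Zariski closure of a subset of a projective space: the common zeros of the homogeneous
polynomials (in linear functions) that vanish on it. -/
def zariskiClosure {W : Type*} [AddCommGroup W] [Module ℂ W] (Z : Set (ℙ ℂ W)) : Set (ℙ ℂ W) :=
  {p | ∀ (n : ℕ) (P : MvPolynomial (Module.Dual ℂ W) ℂ), P.IsHomogeneous n →
    (∀ z ∈ Z, MvPolynomial.eval (fun φ => φ z.rep) P = 0) →
      MvPolynomial.eval (fun φ => φ p.rep) P = 0}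

/-- `R(r, d_0, …, d_q)`: the closure of the image of `ρ`. -/
def ratComponent (r q : ℕ) (d : Fin (q + 1) → ℕ) : Set (ℙ ℂ (twistedForms r q (∑ i, d i))) :=
  zariskiClosure {p | ∃ (F : ∀ i, S r (d i)) (hF : mu r q d F ≠ 0), p = rho r q d F hF}

/-- The subset `U` of `R(r, d_0, …, d_q)` where `codim sing (dω) ≥ 3` and
`codim sing (ω) ≥ 2`. -/
def goodLocus (r q : ℕ) (d : Fin (q + 1) → ℕ) : Set (ℙ ℂ (twistedForms r q (∑ i, d i))) :=
  {p | p ∈ ratComponent r q d ∧ 3 ≤ codim (sing (extD (p.rep : Form r))) ∧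
    2 ≤ codim (sing (p.rep : Form r))}

/-! ### The scheme of foliations and its Zariski tangent spaces -/

/-- The equations of the scheme of codimension `q` foliations: `(i_v ω) ∧ ω = 0` and
`(i_v ω) ∧ dω = 0` for all `v ∈ Λ^{q-1} ℂ^{r+1}`. -/
def FoliationEquations {r : ℕ} (q : ℕ) (ω : Form r) : Prop :=
  ∀ v ∈ ⋀[ℂ]^(q - 1) (Vec r), interiorProd v ω * ω = 0 ∧ interiorProd v ω * extD ω = 0

/-- The forms `η ∈ H⁰(ℙ^r, Ω^q(m))` such that `ω + ε η` satisfies the equations of the scheme of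
foliations modulo `ε²` (for `ω` satisfying them; see `mem_foliationTangentLift_iff`). -/
def foliationTangentLift {r q m : ℕ} (ω : twistedForms r q m) :
    Submodule ℂ (twistedForms r q m) where
  carrier := {η | ∀ v ∈ ⋀[ℂ]^(q - 1) (Vec r),
    interiorProd v (η : Form r) * ω + interiorProd v (ω : Form r) * η = 0 ∧
    interiorProd v (η : Form r) * extD (ω : Form r) +
      interiorProd v (ω : Form r) * extD (η : Form r) = 0}
  zero_mem' v _ := by
    simp only [Submodule.coe_zero, map_zero, zero_mul, mul_zero, add_zero, and_self]
  add_mem' {a b} ha hb v hv := by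
    obtain ⟨ha1, ha2⟩ := ha v hv
    obtain ⟨hb1, hb2⟩ := hb v hv
    rw [Submodule.coe_add, map_add, map_add, add_mul, add_mul, mul_add, mul_add]
    exact ⟨by rw [add_add_add_comm, ha1, hb1, add_zero],
      by rw [add_add_add_comm, ha2, hb2, add_zero]⟩
  smul_mem' c a ha v hv := by
    obtain ⟨ha1, ha2⟩ := ha v hv
    rw [Submodule.coe_smul, map_smul, map_smul, smul_mul_assoc, smul_mul_assoc, mul_smul_comm,
      mul_smul_comm, ← smul_add, ← smul_add, ha1, ha2, smul_zero]
    exact ⟨rfl, rfl⟩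

/-- Extension of a linear map to forms with coefficients in the dual numbers `ℂ[ε]`. -/
def epsExt {r : ℕ} (L : Form r →ₗ[ℂ] Form r) (θ : DualNumber (Form r)) : DualNumber (Form r) :=
  TrivSqZeroExt.inl (L θ.fst) + TrivSqZeroExt.inr (L θ.snd)

/-- At a form `ω` that satisfies the equations, `foliationTangentLift ω` consists of the `η` such
that `ω + ε η` satisfies the same equations over the dual numbers. -/
theorem mem_foliationTangentLift_iff {r q m : ℕ} (ω η : twistedForms r q m)
    (hω : FoliationEquations q (ω : Form r)) :
    η ∈ foliationTangentLift ω ↔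
      ∀ θ : DualNumber (Form r), θ = TrivSqZeroExt.inl (ω : Form r) + TrivSqZeroExt.inr (η : Form r) →
        ∀ v ∈ ⋀[ℂ]^(q - 1) (Vec r),
          epsExt (interiorProd v) θ * θ = 0 ∧ epsExt (interiorProd v) θ * epsExt extD θ = 0 := by
  simp only [forall_eq]
  refine forall₂_congr fun v hv => ?_
  obtain ⟨h1, h2⟩ := hω v hv
  simp [TrivSqZeroExt.ext_iff, epsExt, h1, h2, add_comm]

/-- The Zariski tangent space at `[ω]` of the scheme of codimension `q` foliations, as a subspace
of `T_{[ω]} ℙ(H⁰(ℙ^r, Ω^q(m))) = H⁰(ℙ^r, Ω^q(m)) / (ω)`. -/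
def foliationTangent {r q m : ℕ} (ω : twistedForms r q m) :
    Submodule ℂ (twistedForms r q m ⧸ Submodule.span ℂ {ω}) :=
  (foliationTangentLift ω).map (Submodule.span ℂ {ω}).mkQ

/-! ### The derivative of `ρ` -/

theorem linearDeriv_mu_mem {r q : ℕ} (d : Fin (q + 1) → ℕ) (F : ∀ i, S r (d i)) :
    Submodule.pi Set.univ (fun i => Submodule.span ℂ {F i}) ≤
      (Submodule.span ℂ {mu r q d F}).comap ((mu r q d).linearDeriv F) := by
  intro G hG
  rw [Submodule.mem_comap, MultilinearMap.linearDeriv_apply]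
  refine Submodule.sum_mem _ fun i _ => ?_
  obtain ⟨c, hc⟩ := Submodule.mem_span_singleton.mp (hG i (Set.mem_univ i))
  rw [← hc, MultilinearMap.map_update_smul, Function.update_eq_self]
  exact Submodule.smul_mem _ _ (Submodule.mem_span_singleton_self _)

/-- The derivative at `F = (F_0, …, F_q)` of the map `ρ`: the linear map
`∏ S_{d_i} / (F_i) → H⁰(ℙ^r, Ω^q(∑ d_i)) / (μ F)` between tangent spaces of (products of)
projective spaces that is induced by the derivative at `F` of the multilinear map `μ`. -/
def dRho (r q : ℕ) (d : Fin (q + 1) → ℕ) (F : ∀ i, S r (d i)) :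
    (∀ i, S r (d i) ⧸ Submodule.span ℂ {F i}) →ₗ[ℂ]
      (twistedForms r q (∑ i, d i) ⧸ Submodule.span ℂ {mu r q d F}) :=
  Submodule.mapQ (Submodule.pi Set.univ fun i => Submodule.span ℂ {F i})
      (Submodule.span ℂ {mu r q d F}) ((mu r q d).linearDeriv F) (linearDeriv_mu_mem d F) ∘ₗ
    (Submodule.quotientPi fun i => Submodule.span ℂ {F i}).symm.toLinearMap

end RationalFoliation

end

/-!
Write `θ_i = dF_i` and `Θ = dF_0 ∧ ⋯ ∧ dF_q`, so that `ω = i_R Θ`, and let `m = ∑ d_i`. Cartan's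
formula gives `dω = m Θ`, so at a point of the good locus the zero set of `Θ` has codimension at
least three. The contractions `i_v ω` to `1`-forms are combinations `a` of the `θ_i` with
`i_R a = 0`, whence `a ∧ Θ = 0` and `a ∧ ω = 0` (`foliationEquations_iR_wedge`). Thus rational forms
satisfy the quadratic equations of foliations for all parameters, and polarization in one parameter
puts the image of the derivative into the tangent space (`dRho_mem_foliationTangent`).

For surjectivity let `η` be a first-order deformation of `ω` and `ξ = dη`. The linearized second
equation `i_v η ∧ dω + i_v ω ∧ ξ = 0` implies `θ_a ∧ i_v ω ∧ ξ = 0` for all `a`, because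
`θ_a ∧ Θ = 0`. Generically the `i_v ω` span all combinations
`d_a F_a θ_b - d_b F_b θ_a = i_R (θ_a ∧ θ_b)` (`IsDualFamily.smul_iR_wedge_mem`), so
`θ_a ∧ θ_b ∧ ξ = 0` for all `a` and `b`
(`grad_mul_grad_mul_eq_zero`). Such a closed form is a variation `∑ i, θ_0 ∧ ⋯ ∧ dG_i ∧ ⋯ ∧ θ_q` of
`Θ` (`exists_eq_sum_wedge_update`): each `θ_i ∧ ξ` is divisible by `Θ`, the quotient is a `1`-form
that is closed relative to `F`, hence of the form `± dG_i` modulo the `θ_j`, and what remains of `ξ`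
after subtracting the variation is killed by all `θ_j`, hence a constant multiple of `Θ`. Applying
`i_R` and Cartan's formula to `η`, which is killed by `i_R`, shows that `m η` is the derivative of
`ρ` in the direction `(G_i)`.

The codimension enters through two facts. The first is division by the `θ_j`, of `2`-forms killed by
`Θ` and of forms killed by every `θ_j`. Wherever the `θ_j` are independent it is possible up to a
factor, and these factors generate the ideal `dualIdeal`, whose zero locus lies in that of `Θ`. A
polynomial ideal of height at least three contains a regular sequence of length three
(`exists_isWeaklyRegular_of_le_height`), and along such a sequence solvability of a linear system
descends when the module of its relations is free (`IsRegularTriple.mem_range_of_exact`). The second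
is the relative Poincaré lemma `relative_poincare`, which follows from the division of `2`-forms by
induction on the degree, with Cartan's formula.
-/

open scoped TensorProduct LinearAlgebra.Projectivization

noncomputable section

namespace RationalFoliation

/-! ### Regular sequences in ideals of polynomial rings -/

section Regular

open Polynomial RingTheory.Sequence

/-- A prime of `D[X]` over the zero ideal of a domain `D` has height at most one: it survives in
the principal ideal domain `Frac(D)[X]`. -/
theorem height_le_one_of_comap_C_eq_bot {D : Type*} [CommRing D] [IsDomain D]
    [IsNoetherianRing D] (Q : Ideal D[X]) [Q.IsPrime] (h : Q.comap (C : D →+* D[X]) = ⊥) :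
    Q.height ≤ 1 := by
  let M := (nonZeroDivisors D).map (C : D →+* D[X])
  let : Algebra D[X] (FractionRing D)[X] := Polynomial.algebra D (FractionRing D)
  have : IsLocalization M (FractionRing D)[X] :=
    Polynomial.isLocalization (nonZeroDivisors D) (FractionRing D)
  have hdisj : Disjoint (M : Set D[X]) (Q : Set D[X]) := by
    rw [Set.disjoint_left]
    rintro _ ⟨a, ha, rfl⟩ haQ
    have : a ∈ Q.comap (C : D →+* D[X]) := haQ
    rw [h] at this
    exact nonZeroDivisors.ne_zero ha this
  rw [← IsLocalization.height_map_of_disjoint (S := (FractionRing D)[X]) M Q hdisj]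
  have : (Q.map (algebraMap D[X] (FractionRing D)[X])).IsPrime :=
    IsLocalization.isPrime_of_isPrime_disjoint M _ Q ‹_› hdisj
  set Q' := Q.map (algebraMap D[X] (FractionRing D)[X])
  exact Ideal.height_le_one_of_isPrincipal_of_mem_minimalPrimes Q' Q'
    (by rw [Ideal.minimalPrimes_eq_subsingleton_self]; rfl)

theorem height_le_height_comap_C_add_one {R : Type*} [CommRing R] [IsNoetherianRing R]
    (P : Ideal R[X]) [P.IsPrime] : P.height ≤ (P.comap (C : R →+* R[X])).height + 1 := by
  let p := P.comap (C : R →+* R[X])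
  have : P.LiesOver p := ⟨rfl⟩
  refine (Ideal.height_le_height_add_of_liesOver p P).trans ?_
  gcongr
  let e := (Ideal.polynomialQuotientEquivQuotientPolynomial p).symm
  have hker : RingHom.ker (Ideal.Quotient.mk (p.map (algebraMap R R[X]))) ≤ P := by
    rw [Ideal.mk_ker]; exact Ideal.map_comap_le
  have : (P.map (Ideal.Quotient.mk (p.map (algebraMap R R[X])))).IsPrime :=
    Ideal.map_isPrime_of_surjective Ideal.Quotient.mk_surjective hker
  rw [← e.height_map]
  have : ((P.map (Ideal.Quotient.mk (p.map (algebraMap R R[X])))).map e).IsPrime :=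
    Ideal.map_isPrime_of_equiv e
  refine height_le_one_of_comap_C_eq_bot _ ?_
  rw [eq_bot_iff]
  intro a ha
  obtain ⟨a, rfl⟩ := Ideal.Quotient.mk_surjective a
  have h1 : e (Ideal.Quotient.mk _ (C a)) = C (Ideal.Quotient.mk p a) := by
    rw [Ideal.polynomialQuotientEquivQuotientPolynomial_symm_mk, Polynomial.map_C]
  rw [Ideal.mem_comap, ← h1, Ideal.mem_map_of_equiv] at ha
  obtain ⟨b, hb, hbe⟩ := ha
  rw [e.injective hbe] at hb
  have h2 : C a ∈ P := by
    have := (Ideal.mem_map_iff_of_surjective _ Ideal.Quotient.mk_surjective).mp hb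
    obtain ⟨c, hc, hce⟩ := this
    have h3 : c - C a ∈ P := hker (by rw [RingHom.mem_ker, map_sub, hce]; exact sub_self _)
    simpa using P.sub_mem hc h3
  exact (Submodule.Quotient.mk_eq_zero p).mpr h2

/-- Contracting an ideal of `R[X]` to `R` lowers the height by at most one. -/
theorem le_height_comap_C {R : Type*} [CommRing R] [IsNoetherianRing R] {c : ℕ}
    (J : Ideal R[X]) (h : ((c + 1 : ℕ) : ℕ∞) ≤ J.height) :
    (c : ℕ∞) ≤ (J.comap (C : R →+* R[X])).height := by
  rw [Ideal.height_eq_inf_minimalPrimes (J.comap _)]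
  refine le_iInf₂ fun p hp => ?_
  obtain ⟨P, hP, hJP, rfl⟩ := Ideal.exists_comap_eq_of_mem_minimalPrimes _ p hp
  have h1 := (h.trans (Ideal.height_mono hJP)).trans (height_le_height_comap_C_add_one P)
  push_cast at h1
  exact (ENat.add_le_add_iff_right (by simp)).mp h1

/-- A weakly regular sequence of constants can be extended by a monic polynomial. -/
theorem isWeaklyRegular_map_C_append {R : Type*} [CommRing R] {rs : List R}
    (h : IsWeaklyRegular R rs) {f : R[X]} (hf : f.Monic) :
    IsWeaklyRegular R[X] (rs.map (C : R →+* R[X]) ++ [f]) := by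
  rw [isWeaklyRegular_append_iff]
  refine ⟨h.of_flat, ?_⟩
  rw [isWeaklyRegular_singleton_iff]
  have hI : (Ideal.ofList (rs.map (C : R →+* R[X])) • ⊤ : Submodule R[X] R[X]) =
      (Ideal.ofList rs).map C := by
    rw [smul_eq_mul, Ideal.mul_top, Ideal.map_ofList]
  rw [hI]
  refine IsSMulRegular.of_right_eq_zero_of_smul ?_
  intro x hx
  obtain ⟨x, rfl⟩ := Submodule.Quotient.mk_surjective _ x
  rw [← Submodule.Quotient.mk_smul, Submodule.Quotient.mk_eq_zero, smul_eq_mul] at hx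
  rw [Submodule.Quotient.mk_eq_zero]
  have hk : ∀ y : R[X], y ∈ (Ideal.ofList rs).map C ↔
      y.map (Ideal.Quotient.mk (Ideal.ofList rs)) = 0 := fun y => by
    rw [← coe_mapRingHom, ← RingHom.mem_ker, Polynomial.ker_mapRingHom, Ideal.mk_ker]
  rw [hk, Polynomial.map_mul] at hx
  rw [hk]
  exact (hf.map _).isRegular.left (by simpa using hx)

/-- The linear change of coordinates `x_0 ↦ p_0 x_0`, `x_i ↦ x_i + p_i x_0` for `i ≠ 0`. -/
def shear {k : Type*} [Field k] {n : ℕ} (p : Fin (n + 1) → k) (hp : p 0 ≠ 0) :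
    MvPolynomial (Fin (n + 1)) k ≃ₐ[k] MvPolynomial (Fin (n + 1)) k :=
  AlgEquiv.ofAlgHom
    (MvPolynomial.aeval (Fin.cons (p 0 • MvPolynomial.X 0)
      fun i => MvPolynomial.X i.succ + p i.succ • MvPolynomial.X 0))
    (MvPolynomial.aeval (Fin.cons ((p 0)⁻¹ • MvPolynomial.X 0)
      fun i => MvPolynomial.X i.succ - (p i.succ * (p 0)⁻¹) • MvPolynomial.X 0))
    (by
      ext i : 1
      refine Fin.cases ?_ (fun j => ?_) i
      · simp [smul_smul, hp]
      · simp [smul_smul, hp])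
    (by
      ext i : 1
      refine Fin.cases ?_ (fun j => ?_) i
      · simp [smul_smul, hp]
      · simp [smul_smul])

theorem finSuccEquiv_shear_X {k : Type*} [Field k] {n : ℕ} (p : Fin (n + 1) → k) (hp : p 0 ≠ 0)
    (i : Fin (n + 1)) : ∃ b : MvPolynomial (Fin n) k,
      MvPolynomial.finSuccEquiv k n (shear p hp (MvPolynomial.X i)) =
        C b + C (MvPolynomial.C (p i)) * X := by
  have h (c : k) (a : (MvPolynomial (Fin n) k)[X]) : c • a = C (MvPolynomial.C c) * a :=
    Algebra.smul_def _ _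
  refine Fin.cases ⟨0, ?_⟩ (fun j => ⟨MvPolynomial.X j, ?_⟩) i
  · simp [shear, MvPolynomial.finSuccEquiv_X_zero, h]
  · simp [shear, MvPolynomial.finSuccEquiv_X_zero, MvPolynomial.finSuccEquiv_X_succ, h]

theorem finSuccEquiv_shear_monomial {k : Type*} [Field k] {n : ℕ} (p : Fin (n + 1) → k)
    (hp : p 0 ≠ 0) (m : Fin (n + 1) →₀ ℕ) :
    (MvPolynomial.finSuccEquiv k n (shear p hp (MvPolynomial.monomial m 1))).natDegree ≤ m.degree ∧
    (MvPolynomial.finSuccEquiv k n (shear p hp (MvPolynomial.monomial m 1))).coeff m.degree =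
      MvPolynomial.C (MvPolynomial.eval p (MvPolynomial.monomial m 1)) := by
  induction m using Finsupp.induction_linear with
  | zero => simp
  | add a b ha hb =>
    have h1 : (MvPolynomial.monomial (a + b) (1 : k)) =
        MvPolynomial.monomial a 1 * MvPolynomial.monomial b 1 := by simp
    rw [h1, map_mul, map_mul, map_mul, map_mul, map_add Finsupp.degree]
    refine ⟨natDegree_mul_le_of_le ha.1 hb.1, ?_⟩
    rw [coeff_mul_add_eq_of_natDegree_le ha.1 hb.1, ha.2, hb.2]
  | single i e =>
    obtain ⟨b, hb⟩ := finSuccEquiv_shear_X p hp i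
    have h1 : (MvPolynomial.monomial (Finsupp.single i e) (1 : k)) = MvPolynomial.X i ^ e := by
      rw [MvPolynomial.X_pow_eq_monomial]
    have h2 : (C b + C (MvPolynomial.C (p i)) * X).natDegree ≤ 1 := by
      rw [add_comm]; exact natDegree_linear_le
    rw [h1, map_pow, map_pow, hb, Finsupp.degree_single]
    refine ⟨(natDegree_pow_le_of_le e h2).trans (by simp), ?_⟩
    have h3 := coeff_pow_of_natDegree_le h2 (m := e)
    rw [mul_one] at h3
    simp [h3]

/-- After a general linear change of coordinates a nonzero polynomial is, up to a unit, monic in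
the first variable: the leading coefficient is the value of the top homogeneous component at a
point. -/
theorem exists_shear_isUnit_leadingCoeff {k : Type*} [Field k] [Infinite k] {n : ℕ}
    (f : MvPolynomial (Fin (n + 1)) k) (hf : f ≠ 0) :
    ∃ (p : Fin (n + 1) → k) (hp : p 0 ≠ 0),
      IsUnit (MvPolynomial.finSuccEquiv k n (shear p hp f)).leadingCoeff := by
  set N := f.totalDegree
  have hN : MvPolynomial.homogeneousComponent N f ≠ 0 := by
    intro h0
    obtain ⟨m, hm, hmN⟩ := Finset.exists_mem_eq_sup f.support
      (MvPolynomial.support_nonempty.mpr hf) (fun s => Finsupp.degree s)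
    have h1 : Finsupp.degree m = N := by
      rw [← hmN]; rfl
    have h2 := congrArg (MvPolynomial.coeff m) h0
    rw [MvPolynomial.coeff_homogeneousComponent, if_pos h1, MvPolynomial.coeff_zero] at h2
    exact MvPolynomial.mem_support_iff.mp hm h2
  have h1 : MvPolynomial.X 0 * MvPolynomial.homogeneousComponent N f ≠ 0 :=
    mul_ne_zero (MvPolynomial.X_ne_zero 0) hN
  obtain ⟨p, hp⟩ : ∃ p, MvPolynomial.eval p
      (MvPolynomial.X 0 * MvPolynomial.homogeneousComponent N f) ≠ 0 := by
    by_contra! h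
    exact h1 (MvPolynomial.funext fun p => by rw [h p, map_zero])
  rw [map_mul, MvPolynomial.eval_X] at hp
  have hp0 := left_ne_zero_of_mul hp
  have hpN := right_ne_zero_of_mul hp
  refine ⟨p, hp0, ?_⟩
  have hsum : MvPolynomial.finSuccEquiv k n (shear p hp0 f) = ∑ m ∈ f.support,
      MvPolynomial.coeff m f •
        MvPolynomial.finSuccEquiv k n (shear p hp0 (MvPolynomial.monomial m 1)) := by
    conv_lhs => rw [f.as_sum]
    rw [map_sum, map_sum]
    refine Finset.sum_congr rfl fun m _ => ?_
    rw [← map_smul, ← map_smul, MvPolynomial.smul_monomial, smul_eq_mul, mul_one]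
  have hdeg : (MvPolynomial.finSuccEquiv k n (shear p hp0 f)).natDegree ≤ N := by
    rw [hsum]
    refine natDegree_sum_le_of_forall_le _ _ fun m hm => ?_
    exact (natDegree_smul_le _ _).trans ((finSuccEquiv_shear_monomial p hp0 m).1.trans
      (Finset.le_sup (f := fun s => Finsupp.degree s) hm))
  have hcoeff : (MvPolynomial.finSuccEquiv k n (shear p hp0 f)).coeff N =
      MvPolynomial.C (MvPolynomial.eval p (MvPolynomial.homogeneousComponent N f)) := by
    rw [hsum, finsetSum_coeff, MvPolynomial.homogeneousComponent_apply, map_sum, map_sum,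
      Finset.sum_filter]
    refine Finset.sum_congr rfl fun m hm => ?_
    rw [coeff_smul]
    split_ifs with h
    · rw [← h, (finSuccEquiv_shear_monomial p hp0 m).2, MvPolynomial.eval_monomial,
        MvPolynomial.eval_monomial, one_mul, map_mul, MvPolynomial.smul_eq_C_mul]
    · rw [coeff_eq_zero_of_natDegree_lt, smul_zero]
      exact (finSuccEquiv_shear_monomial p hp0 m).1.trans_lt
        (lt_of_le_of_ne (Finset.le_sup (f := fun s => Finsupp.degree s) hm) h)
  have hu : IsUnit ((MvPolynomial.finSuccEquiv k n (shear p hp0 f)).coeff N) := by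
    rw [hcoeff]
    exact (isUnit_iff_ne_zero.mpr hpN).map MvPolynomial.C
  have : (MvPolynomial.finSuccEquiv k n (shear p hp0 f)).natDegree = N :=
    le_antisymm hdeg (le_natDegree_of_ne_zero hu.ne_zero)
  rwa [leadingCoeff, this]

/-- An ideal of height at least `c` in a polynomial ring over an infinite field contains a weakly
regular sequence of length `c`. By induction on the number of variables: after a change of
coordinates the ideal contains a polynomial that is monic in the first variable, and it is put
behind a sequence in the contraction of the ideal to the other variables. -/
theorem exists_isWeaklyRegular_of_le_height {k : Type*} [Field k] [Infinite k] {n c : ℕ}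
    (J : Ideal (MvPolynomial (Fin n) k)) (h : (c : ℕ∞) ≤ J.height) :
    ∃ rs : List (MvPolynomial (Fin n) k), rs.length = c ∧ (∀ x ∈ rs, x ∈ J) ∧
      IsWeaklyRegular (MvPolynomial (Fin n) k) rs := by
  induction n generalizing c with
  | zero =>
    by_cases hJ : J = ⊥
    · rw [hJ, Ideal.height_bot] at h
      obtain rfl : c = 0 := by exact_mod_cast nonpos_iff_eq_zero.mp h
      exact ⟨[], rfl, by simp, .nil _ _⟩
    · obtain ⟨f, hfJ, hf⟩ := Submodule.exists_mem_ne_zero_of_ne_bot hJ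
      have hu : IsUnit f := by
        rw [MvPolynomial.eq_C_of_isEmpty f] at hf ⊢
        exact (isUnit_iff_ne_zero.mpr fun h0 => hf (by rw [h0, map_zero])).map MvPolynomial.C
      have h1 : (1 : MvPolynomial (Fin 0) k) ∈ J :=
        (Ideal.eq_top_iff_one J).mp (J.eq_top_of_isUnit_mem hfJ hu)
      refine ⟨List.replicate c 1, by simp, fun x hx => (List.eq_of_mem_replicate hx) ▸ h1, ?_⟩
      refine ⟨fun i hi => ?_⟩
      rw [List.getElem_replicate]
      exact IsSMulRegular.one _
  | succ n ih =>
    rcases c with _ | c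
    · exact ⟨[], rfl, by simp, .nil _ _⟩
    have hJ : J ≠ ⊥ := by
      rintro rfl
      rw [Ideal.height_bot] at h
      simp at h
    obtain ⟨f, hfJ, hf⟩ := Submodule.exists_mem_ne_zero_of_ne_bot hJ
    obtain ⟨p, hp, hu⟩ := exists_shear_isUnit_leadingCoeff f hf
    let e : MvPolynomial (Fin (n + 1)) k ≃+* (MvPolynomial (Fin n) k)[X] :=
      ((shear p hp).trans (MvPolynomial.finSuccEquiv k n)).toRingEquiv
    have h1 : ((c + 1 : ℕ) : ℕ∞) ≤ (J.comap e.symm).height := by rwa [RingEquiv.height_comap]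
    obtain ⟨rs, hlen, hmem, hreg⟩ := ih _ (le_height_comap_C _ h1)
    have hmonic : (C (↑hu.unit⁻¹ : MvPolynomial (Fin n) k) * e f).Monic := by
      have h2 := monic_of_isUnit_leadingCoeff_inv_smul hu
      rwa [Units.smul_def, smul_eq_C_mul] at h2
    have hreg' := isWeaklyRegular_map_C_append hreg hmonic
    refine ⟨(rs.map C ++ [C (↑hu.unit⁻¹ : MvPolynomial (Fin n) k) * e f]).map e.symm,
      by simp [hlen], ?_, ?_⟩
    · intro x hx
      obtain ⟨y, hy, rfl⟩ := List.mem_map.mp hx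
      rcases List.mem_append.mp hy with hy | hy
      · obtain ⟨z, hz, rfl⟩ := List.mem_map.mp hy
        exact hmem z hz
      · rw [List.mem_singleton.mp hy, map_mul, RingEquiv.symm_apply_apply]
        exact J.mul_mem_left _ hfJ
    · refine (AddEquiv.isWeaklyRegular_congr (e := e.symm.toAddEquiv) ?_).mp hreg'
      refine List.forall₂_map_right_iff.mpr (List.forall₂_same.mpr fun r _ x => ?_)
      simp

/-- A regular sequence of length three, in terms of elements. -/
structure IsRegularTriple {R : Type*} [CommRing R] (f g h : R) : Prop where
  fst {x : R} : f * x = 0 → x = 0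
  snd {x y : R} : g * x = f * y → ∃ z, x = f * z
  thd {x y z : R} : h * x = f * y + g * z → ∃ u v, x = f * u + g * v

theorem IsRegularTriple.of_isWeaklyRegular {R : Type*} [CommRing R] {f g h : R}
    (H : IsWeaklyRegular R [f, g, h]) : IsRegularTriple f g h := by
  have key : ∀ (I : Ideal R) (a x : R), IsSMulRegular (R ⧸ (I • ⊤ : Submodule R R)) a →
      a * x ∈ I → x ∈ I := by
    intro I a x hreg hx
    rw [smul_eq_mul, Ideal.mul_top] at hreg
    have := hreg.right_eq_zero_of_smul (x := Submodule.Quotient.mk x)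
      (by rw [← Submodule.Quotient.mk_smul, Submodule.Quotient.mk_eq_zero]; exact hx)
    rwa [Submodule.Quotient.mk_eq_zero] at this
  have h0 := H.regular_mod_prev 0 (by simp)
  have h1 := H.regular_mod_prev 1 (by simp)
  have h2 := H.regular_mod_prev 2 (by simp)
  simp only [List.take_zero, List.take_succ_cons, List.getElem_cons_zero,
    List.getElem_cons_succ] at h0 h1 h2
  refine ⟨fun {x} hx => ?_, fun {x y} hx => ?_, fun {x y z} hx => ?_⟩
  · simpa using key _ _ x h0 (by rw [hx]; exact zero_mem _)
  · have := key _ _ x h1 (by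
      rw [hx, Ideal.ofList_singleton]; exact Ideal.mul_mem_right _ _ (Ideal.mem_span_singleton_self _))
    rw [Ideal.ofList_singleton, Ideal.mem_span_singleton] at this
    exact this
  · have hI : (Ideal.ofList [f, g] : Ideal R) = Ideal.span {f, g} := by
      rw [Ideal.ofList_cons, Ideal.ofList_singleton, ← Ideal.span_union]; rfl
    have := key _ _ x h2 (by
      rw [hx, hI]; exact Ideal.mem_span_pair.mpr ⟨y, z, by ring⟩)
    rw [hI] at this
    obtain ⟨u, v, huv⟩ := Ideal.mem_span_pair.mp this
    exact ⟨u, v, by rw [← huv]; ring⟩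

/-- By the Nullstellensatz, an ideal whose zero locus lies in an algebraic set of codimension at
least three contains a regular sequence of length three. -/
theorem exists_isRegularTriple {r : ℕ} (J : Ideal (Poly r)) (Z : Set (Vec r))
    (hJ : MvPolynomial.zeroLocus ℂ J ⊆ Z) (hZ : 3 ≤ codim Z) :
    ∃ f ∈ J, ∃ g ∈ J, ∃ h ∈ J, IsRegularTriple f g h := by
  have h3 : ((3 : ℕ) : ℕ∞) ≤ J.height := by
    rw [Ideal.height_eq_inf_minimalPrimes]
    refine le_iInf₂ fun P hP => ?_
    have := hP.isPrime
    refine hZ.trans (Ideal.height_mono ?_)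
    rw [← MvPolynomial.IsPrime.vanishingIdeal_zeroLocus (K := ℂ) P]
    exact MvPolynomial.vanishingIdeal_anti_mono
      ((MvPolynomial.zeroLocus_anti_mono hP.1.2).trans hJ)
  obtain ⟨rs, hlen, hmem, hreg⟩ := exists_isWeaklyRegular_of_le_height J h3
  obtain ⟨f, g, h, rfl⟩ := List.length_eq_three.mp hlen
  exact ⟨f, hmem f (by simp), g, hmem g (by simp), h, hmem h (by simp),
    .of_isWeaklyRegular hreg⟩

end Regular

/-! ### Descent of solvability along regular sequences -/

section Descent

variable {R : Type*} [CommRing R] {M : Type*} [AddCommGroup M] [Module R M]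
  {κ ι : Type*} {f g h : R}

/-- If `Φ` is injective on a free module, then `M / im Φ` has no element that is killed by a
regular sequence of length two: depth two gives `Hom(R/J, M / im Φ) ⊆ Ext¹(R/J, ι → R) = 0`. -/
theorem IsRegularTriple.mem_range_of_injective (H : IsRegularTriple f g h)
    (hM : ∀ m : M, f • m = 0 → m = 0) (Φ : (ι → R) →ₗ[R] M) (hΦ : Function.Injective Φ) {ξ : M}
    (hf : f • ξ ∈ LinearMap.range Φ) (hg : g • ξ ∈ LinearMap.range Φ) : ξ ∈ LinearMap.range Φ := by
  obtain ⟨a, ha⟩ := hf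
  obtain ⟨b, hb⟩ := hg
  have h1 : g • a = f • b := hΦ (by rw [map_smul, map_smul, ha, hb, smul_comm])
  choose c hc using fun i => H.snd (congrFun h1 i)
  have hac : a = f • c := funext hc
  refine ⟨c, ?_⟩
  rw [← sub_eq_zero]
  refine hM _ ?_
  rw [smul_sub, ← ha, hac, map_smul, sub_self]

/-- If `0 → (κ → R) → (ι → R) → M` is exact, then `M / im Φ` has no element that is killed by a
regular sequence of length three: depth three gives
`Hom(R/J, M / im Φ) ⊆ Ext¹(R/J, im Φ) ⊆ Ext²(R/J, κ → R) = 0`. -/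
theorem IsRegularTriple.mem_range_of_exact (H : IsRegularTriple f g h)
    (hM : ∀ m : M, f • m = 0 → m = 0) (Ψ : (κ → R) →ₗ[R] (ι → R)) (hΨ : Function.Injective Ψ)
    (Φ : (ι → R) →ₗ[R] M) (hex : ∀ a, Φ a = 0 → a ∈ LinearMap.range Ψ) (hz : ∀ s, Φ (Ψ s) = 0)
    {ξ : M} (hf : f • ξ ∈ LinearMap.range Φ) (hg : g • ξ ∈ LinearMap.range Φ)
    (hh : h • ξ ∈ LinearMap.range Φ) : ξ ∈ LinearMap.range Φ := by
  obtain ⟨a, ha⟩ := hf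
  obtain ⟨b, hb⟩ := hg
  obtain ⟨c, hc⟩ := hh
  obtain ⟨k₁, hk₁⟩ := hex (g • a - f • b) (by
    rw [map_sub, map_smul, map_smul, ha, hb, smul_comm, sub_self])
  obtain ⟨k₂, hk₂⟩ := hex (h • a - f • c) (by
    rw [map_sub, map_smul, map_smul, ha, hc, smul_comm, sub_self])
  obtain ⟨k₃, hk₃⟩ := hex (h • b - g • c) (by
    rw [map_sub, map_smul, map_smul, hb, hc, smul_comm, sub_self])
  have h1 : h • k₁ = f • (-k₃) + g • k₂ := hΨ (by
    rw [map_add, map_smul, map_smul, map_smul, map_neg, hk₁, hk₂, hk₃]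
    module)
  choose u v huv using fun i => H.thd (congrFun h1 i)
  have hk : k₁ = f • u + g • v := funext huv
  have h2 : g • (a - Ψ v) = f • (b + Ψ u) := by
    rw [hk, map_add, map_smul, map_smul] at hk₁
    rw [smul_sub, smul_add, sub_eq_iff_eq_add, add_assoc, hk₁]
    module
  choose p hp using fun i => H.snd (congrFun h2 i)
  have hap : a - Ψ v = f • p := funext hp
  refine ⟨p, ?_⟩
  rw [← sub_eq_zero]
  refine hM _ ?_
  rw [smul_sub, ← map_smul, ← hap, map_sub, ha, hz, sub_zero, sub_self]

end Descent

/-! ### Polynomial forms as an algebra over the polynomial ring -/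

section Calculus

variable {r : ℕ}

instance : Algebra (Poly r) (Form r) :=
  inferInstanceAs (Algebra (Poly r) (Poly r ⊗[ℂ] ConstForm r))

instance : IsScalarTower ℂ (Poly r) (Form r) :=
  inferInstanceAs (IsScalarTower ℂ (Poly r) (Poly r ⊗[ℂ] ConstForm r))

instance : Module.Free (Poly r) (Form r) :=
  inferInstanceAs (Module.Free (Poly r) (Poly r ⊗[ℂ] ConstForm r))

theorem smul_mk (f g : Poly r) (α : ConstForm r) : f • Form.mk g α = Form.mk (f * g) α := by
  rfl

theorem mk_eq_smul (f : Poly r) (α : ConstForm r) : Form.mk f α = f • Form.mk 1 α := by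
  rw [smul_mk, mul_one]

theorem form_smul_eq_zero {f : Poly r} {ζ : Form r} (hf : f ≠ 0) (h : f • ζ = 0) : ζ = 0 :=
  (smul_eq_zero.mp h).resolve_left hf

/-- Polynomial `1`-forms, as covector fields: `oneForm a = ∑ i, a_i dx_i`. -/
def oneForm : (Fin (r + 1) → Poly r) →ₗ[Poly r] Form r :=
  Fintype.linearCombination (Poly r) fun i => Form.mk 1 (dx i)

theorem oneForm_apply (a : Fin (r + 1) → Poly r) : oneForm a = ∑ i, Form.mk (a i) (dx i) := by
  simp [oneForm, Fintype.linearCombination_apply, smul_mk]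

/-- The interior product with the constant vector `v`, as a map linear over polynomials. -/
def contractConst (v : Vec r) : Form r →ₗ[Poly r] Form r where
  toFun := Form.map LinearMap.id (contractVec v)
  map_add' := map_add _
  map_smul' f ζ := by
    induction ζ using Form.induction with
    | zero => simp
    | mk g α => simp [smul_mk, Form.map_mk]
    | add a b ha hb => rw [smul_add, map_add, ha, hb, map_add, smul_add]

theorem contractConst_mk (v : Vec r) (f : Poly r) (α : ConstForm r) :
    contractConst v (Form.mk f α) = Form.mk f (contractVec v α) :=
  Form.map_mk _ _ _ _

/-- The interior product with the polynomial vector field `∑ i, w_i ∂/∂x_i`. -/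
def contract : (Fin (r + 1) → Poly r) →ₗ[Poly r] Module.End (Poly r) (Form r) :=
  Fintype.linearCombination (Poly r) fun i => contractConst (Pi.single i 1)

theorem contract_apply (w : Fin (r + 1) → Poly r) (ζ : Form r) :
    contract w ζ = ∑ i, w i • contractConst (Pi.single i 1) ζ := by
  simp [contract, Fintype.linearCombination_apply]

theorem iR_eq_contract (ζ : Form r) : iR ζ = contract MvPolynomial.X ζ := by
  induction ζ using Form.induction with
  | zero => simp
  | mk f α => simp [iR, contract_apply, contractConst_mk, smul_mk, Form.map_mk]
  | add a b ha hb => rw [map_add, map_add, ha, hb]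

theorem contractVec_dx_mul (v : Vec r) (i : Fin (r + 1)) (α : ConstForm r) :
    contractVec v (dx i * α) = v i • α - dx i * contractVec v α :=
  CliffordAlgebra.contractLeft_ι_mul (Q := (0 : QuadraticForm ℂ (Module.Dual ℂ (Vec r))))
    (d := Module.Dual.eval ℂ (Vec r) v) _ α

theorem dx_mul_dx_add (i j : Fin (r + 1)) : (dx i * dx j + dx j * dx i : ConstForm r) = 0 :=
  ExteriorAlgebra.ι_add_mul_swap _ _

theorem contractVec_one (v : Vec r) : contractVec v (1 : ConstForm r) = 0 :=
  CliffordAlgebra.contractLeft_one (Q := (0 : QuadraticForm ℂ (Module.Dual ℂ (Vec r)))) _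

theorem contractConst_dx_mul (v : Vec r) (i : Fin (r + 1)) (ζ : Form r) :
    contractConst v (Form.mk 1 (dx i) * ζ) =
      v i • ζ - Form.mk 1 (dx i) * contractConst v ζ := by
  induction ζ using Form.induction with
  | zero => simp
  | mk f α =>
    simp only [Form.mk_mul_mk, contractConst_mk, contractVec_dx_mul, map_sub, map_smul, one_mul]
  | add a b ha hb => rw [mul_add, map_add, ha, hb, map_add, smul_add, mul_add]; abel

/-- The interior product is an antiderivation. -/
theorem contract_oneForm_mul (w a : Fin (r + 1) → Poly r) (ζ : Form r) :
    contract w (oneForm a * ζ) = (w ⬝ᵥ a) • ζ - oneForm a * contract w ζ := by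
  have key : ∀ i, contract w (Form.mk 1 (dx i) * ζ) =
      w i • ζ - Form.mk 1 (dx i) * contract w ζ := by
    intro i
    simp only [contract_apply, contractConst_dx_mul, smul_sub, Finset.sum_sub_distrib,
      Finset.mul_sum, mul_smul_comm]
    congr 1
    rw [Finset.sum_eq_single i]
    · simp
    · intro j _ hj
      simp [hj.symm]
    · simp
  have h : oneForm a = ∑ i, a i • Form.mk 1 (dx i) := Fintype.linearCombination_apply _ _ _
  have h1 : contract w (oneForm a * ζ) =
      ∑ i, ((a i * w i) • ζ - a i • (Form.mk 1 (dx i) * contract w ζ)) := by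
    rw [h, Finset.sum_mul, map_sum]
    exact Finset.sum_congr rfl fun i _ => by
      rw [smul_mul_assoc, map_smul, key, smul_sub, smul_smul]
  have h2 : oneForm a * contract w ζ = ∑ i, a i • (Form.mk 1 (dx i) * contract w ζ) := by
    rw [h, Finset.sum_mul]
    exact Finset.sum_congr rfl fun i _ => smul_mul_assoc _ _ _
  rw [h1, h2, Finset.sum_sub_distrib, ← Finset.sum_smul, dotProduct_comm]
  rfl

theorem contract_one (w : Fin (r + 1) → Poly r) : contract w (1 : Form r) = 0 := by
  simp [contract_apply, ← Form.mk_one_one, contractConst_mk, contractVec_one]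

theorem contract_oneForm (w a : Fin (r + 1) → Poly r) :
    contract w (oneForm a) = (w ⬝ᵥ a) • (1 : Form r) := by
  have := contract_oneForm_mul w a 1
  rwa [mul_one, contract_one, mul_zero, sub_zero] at this

theorem smul_one_injective {f : Poly r} (h : f • (1 : Form r) = 0) : f = 0 := by
  have h1 : (1 : Form r) ≠ 0 := by
    intro h0
    have : Nontrivial (Poly r ⊗[ℂ] ConstForm r) := inferInstance
    exact one_ne_zero (α := Poly r ⊗[ℂ] ConstForm r) h0
  exact (smul_eq_zero.mp h).resolve_right h1

theorem oneForm_injective : Function.Injective (oneForm (r := r)) := by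
  refine (injective_iff_map_eq_zero _).mpr fun a ha => funext fun i => ?_
  refine smul_one_injective ?_
  have := contract_oneForm (Pi.single i 1) a
  rw [ha, map_zero] at this
  simpa using this.symm

theorem contract_contract (w u : Fin (r + 1) → Poly r) (ζ : Form r) :
    contract w (contract u ζ) = -contract u (contract w ζ) := by
  have key : ∀ i j, contractConst (Pi.single i 1) (contractConst (Pi.single j 1) ζ) =
      -contractConst (Pi.single j 1) (contractConst (Pi.single i 1) ζ) := by
    intro i j
    induction ζ using Form.induction with
    | zero => simp
    | mk f α =>
      rw [contractConst_mk, contractConst_mk, contractConst_mk, contractConst_mk, ← map_neg]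
      exact congrArg _ (CliffordAlgebra.contractLeft_comm _ _ _)
    | add a b ha hb => simp only [map_add, ha, hb, neg_add]
  simp only [contract_apply, map_sum, map_smul, Finset.smul_sum]
  rw [Finset.sum_comm, ← Finset.sum_neg_distrib]
  refine Finset.sum_congr rfl fun i _ => ?_
  rw [← Finset.sum_neg_distrib]
  refine Finset.sum_congr rfl fun j _ => ?_
  rw [key j i, smul_neg, smul_neg, neg_neg, smul_comm]

theorem oneForm_mul_self (a : Fin (r + 1) → Poly r) : oneForm a * oneForm a = 0 := by
  have h : oneForm a * oneForm a = -(oneForm a * oneForm a) := by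
    simp only [oneForm_apply, Finset.sum_mul, Finset.mul_sum, Form.mk_mul_mk]
    conv_lhs => rw [Finset.sum_comm]
    rw [← Finset.sum_neg_distrib]
    refine Finset.sum_congr rfl fun i _ => ?_
    rw [← Finset.sum_neg_distrib]
    refine Finset.sum_congr rfl fun j _ => ?_
    rw [mul_comm (a j), ← map_neg, ← eq_neg_of_add_eq_zero_left (dx_mul_dx_add i j)]
  have h2 : (2 : ℂ) • (oneForm a * oneForm a) = 0 := by
    rw [two_smul]
    exact eq_neg_iff_add_eq_zero.mp h
  exact (smul_eq_zero.mp h2).resolve_left two_ne_zero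

theorem oneForm_mul_comm (a b : Fin (r + 1) → Poly r) :
    oneForm a * oneForm b = -(oneForm b * oneForm a) := by
  have := oneForm_mul_self (a + b)
  rw [map_add, mul_add, add_mul, add_mul, oneForm_mul_self, oneForm_mul_self, zero_add,
    add_zero] at this
  exact eq_neg_of_add_eq_zero_right this

/-- The product of `1`-forms, as an alternating map over polynomials. -/
def wedge (n : ℕ) : (Fin (r + 1) → Poly r) [⋀^Fin n]→ₗ[Poly r] Form r :=
  (ExteriorAlgebra.lift (Poly r)
    ⟨oneForm, oneForm_mul_self⟩).toLinearMap.compAlternatingMap (ExteriorAlgebra.ιMulti (Poly r) n)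

theorem wedge_apply {n : ℕ} (θ : Fin n → Fin (r + 1) → Poly r) :
    wedge n θ = (List.ofFn fun i => oneForm (θ i)).prod := by
  rw [wedge, LinearMap.compAlternatingMap_apply, ExteriorAlgebra.ιMulti_apply,
    AlgHom.toLinearMap_apply, map_list_prod, List.map_ofFn]
  simp [Function.comp_def]

theorem wedge_succ {n : ℕ} (θ : Fin (n + 1) → Fin (r + 1) → Poly r) :
    wedge (n + 1) θ = oneForm (θ 0) * wedge n fun i => θ i.succ := by
  rw [wedge_apply, wedge_apply, List.ofFn_succ, List.prod_cons]

theorem wedge_zero (θ : Fin 0 → Fin (r + 1) → Poly r) : wedge 0 θ = 1 := by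
  rw [wedge_apply, List.ofFn_zero, List.prod_nil]

theorem oneForm_mul_wedge_self {n : ℕ} (θ : Fin n → Fin (r + 1) → Poly r) (j : Fin n) :
    oneForm (θ j) * wedge n θ = 0 := by
  have h := (wedge (r := r) (n + 1)).map_eq_zero_of_eq (Fin.cons (θ j) θ) (i := 0) (j := j.succ)
    (by simp) (Fin.succ_ne_zero j).symm
  rw [wedge_succ] at h
  simpa using h

/-- The polynomial forms that are sums of products of `p` members of a module `U` of `1`-forms;
for the module of all `1`-forms these are the `p`-forms. -/
def formsOf (U : Submodule (Poly r) (Fin (r + 1) → Poly r)) (p : ℕ) :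
    Submodule (Poly r) (Form r) :=
  (U.map oneForm) ^ p

theorem oneForm_mem_formsOf {U : Submodule (Poly r) (Fin (r + 1) → Poly r)}
    {a : Fin (r + 1) → Poly r} (ha : a ∈ U) : oneForm a ∈ formsOf U 1 := by
  rw [formsOf, pow_one]
  exact Submodule.mem_map_of_mem ha

theorem mem_formsOf_one {U : Submodule (Poly r) (Fin (r + 1) → Poly r)} {ζ : Form r} :
    ζ ∈ formsOf U 1 ↔ ∃ a ∈ U, oneForm a = ζ := by
  rw [formsOf, pow_one, Submodule.mem_map]

theorem mem_formsOf_zero {U : Submodule (Poly r) (Fin (r + 1) → Poly r)} {ζ : Form r} :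
    ζ ∈ formsOf U 0 ↔ ∃ f : Poly r, ζ = f • 1 := by
  rw [formsOf, pow_zero, Submodule.mem_one]
  exact exists_congr fun f => by rw [Algebra.algebraMap_eq_smul_one, eq_comm]

theorem mul_mem_formsOf {U : Submodule (Poly r) (Fin (r + 1) → Poly r)} {p p' : ℕ}
    {ζ ξ : Form r} (hζ : ζ ∈ formsOf U p) (hξ : ξ ∈ formsOf U p') :
    ζ * ξ ∈ formsOf U (p + p') := by
  rw [formsOf, pow_add]
  exact Submodule.mul_mem_mul hζ hξ

/-- Induction for forms with one more factor. -/
theorem formsOf_succ_induction {U : Submodule (Poly r) (Fin (r + 1) → Poly r)} {p : ℕ}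
    {C : Form r → Prop} (add : ∀ ζ ξ, C ζ → C ξ → C (ζ + ξ))
    (mul : ∀ a ∈ U, ∀ ζ ∈ formsOf U p, C (oneForm a * ζ)) {ζ : Form r}
    (hζ : ζ ∈ formsOf U (p + 1)) : C ζ := by
  rw [formsOf, pow_succ'] at hζ
  refine Submodule.mul_induction_on hζ ?_ add
  rintro _ ⟨a, ha, rfl⟩ ξ hξ
  exact mul a ha ξ hξ

theorem oneForm_mul_mem {U : Submodule (Poly r) (Fin (r + 1) → Poly r)} {p : ℕ}
    {a : Fin (r + 1) → Poly r} (ha : a ∈ U) {ζ : Form r} (hζ : ζ ∈ formsOf U p) :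
    oneForm a * ζ ∈ formsOf U (p + 1) := by
  rw [add_comm p 1]
  exact mul_mem_formsOf (oneForm_mem_formsOf ha) hζ

theorem wedge_mem_formsOf {U : Submodule (Poly r) (Fin (r + 1) → Poly r)} {n : ℕ}
    {θ : Fin n → Fin (r + 1) → Poly r} (h : ∀ i, θ i ∈ U) : wedge n θ ∈ formsOf U n := by
  induction n with
  | zero => rw [wedge_zero]; exact mem_formsOf_zero.mpr ⟨1, by simp⟩
  | succ n ih =>
    rw [wedge_succ]
    exact oneForm_mul_mem (h 0) (ih fun i => h i.succ)

theorem contract_mem_formsOf {U : Submodule (Poly r) (Fin (r + 1) → Poly r)}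
    (w : Fin (r + 1) → Poly r) {p : ℕ} {ζ : Form r} (hζ : ζ ∈ formsOf U (p + 1)) :
    contract w ζ ∈ formsOf U p := by
  induction p generalizing ζ with
  | zero =>
    obtain ⟨a, -, rfl⟩ := mem_formsOf_one.mp hζ
    exact mem_formsOf_zero.mpr ⟨_, contract_oneForm w a⟩
  | succ p ih =>
    refine formsOf_succ_induction (C := fun ζ => contract w ζ ∈ formsOf U (p + 1))
      (fun ζ ξ h1 h2 => by rw [map_add]; exact add_mem h1 h2) (fun a ha ζ hζ => ?_) hζ
    rw [contract_oneForm_mul]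
    exact sub_mem (Submodule.smul_mem _ _ hζ) (oneForm_mul_mem ha (ih hζ))

theorem oneForm_mul_comm_of_mem {U : Submodule (Poly r) (Fin (r + 1) → Poly r)} {p : ℕ}
    {ζ : Form r} (hζ : ζ ∈ formsOf U p) (a : Fin (r + 1) → Poly r) :
    oneForm a * ζ = (-1 : ℂ) ^ p • (ζ * oneForm a) := by
  induction p generalizing ζ with
  | zero =>
    obtain ⟨f, rfl⟩ := mem_formsOf_zero.mp hζ
    simp
  | succ p ih =>
    refine formsOf_succ_induction
      (C := fun ζ => oneForm a * ζ = (-1 : ℂ) ^ (p + 1) • (ζ * oneForm a))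
      (fun ζ ξ h1 h2 => by rw [mul_add, h1, h2, add_mul, smul_add]) (fun b hb ζ hζ => ?_) hζ
    rw [← mul_assoc, oneForm_mul_comm a b, neg_mul, mul_assoc, ih hζ, mul_smul_comm, mul_assoc,
      pow_succ, mul_neg_one, neg_smul]

theorem mk_one_mem_formsOf {p : ℕ} {α : ConstForm r}
    (hα : α ∈ ⋀[ℂ]^p (Module.Dual ℂ (Vec r))) : Form.mk 1 α ∈ formsOf (r := r) ⊤ p := by
  have hι : ∀ φ : Module.Dual ℂ (Vec r), (ExteriorAlgebra.ι ℂ φ : ConstForm r) =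
      ∑ i, φ (Pi.single i 1) • dx i := by
    intro φ
    simp only [dx, ← map_smul, ← map_sum]
    congr 1
    refine LinearMap.pi_ext' fun i => LinearMap.ext_ring ?_
    simp [Pi.single_apply]
  induction p generalizing α with
  | zero =>
    rw [ExteriorAlgebra.exteriorPower, pow_zero] at hα
    obtain ⟨c, rfl⟩ := Submodule.mem_one.mp hα
    refine mem_formsOf_zero.mpr ⟨MvPolynomial.C c, ?_⟩
    rw [Algebra.algebraMap_eq_smul_one, map_smul, Form.mk_one_one]
    exact (algebraMap_smul (Poly r) c (1 : Form r)).symm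
  | succ p ih =>
    rw [ExteriorAlgebra.exteriorPower, pow_succ'] at hα
    refine Submodule.mul_induction_on hα ?_
      (fun a b ha hb => by rw [map_add]; exact add_mem ha hb)
    rintro _ ⟨φ, rfl⟩ β hβ
    rw [hι, Finset.sum_mul, map_sum]
    refine sum_mem fun i _ => ?_
    have : Form.mk (1 : Poly r) (φ (Pi.single i 1) • dx i * β) =
        oneForm (φ (Pi.single i 1) • Pi.single i 1) * Form.mk 1 β := by
      have h1 : oneForm (Pi.single i (1 : Poly r)) = Form.mk 1 (dx i) := by
        simp [oneForm]
      rw [LinearMap.map_smul_of_tower, h1, smul_mul_assoc, smul_mul_assoc, Form.mk_mul_mk, one_mul,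
        map_smul]
    rw [this]
    exact oneForm_mul_mem Submodule.mem_top (ih hβ)

theorem homForms_le_formsOf {p m : ℕ} {ζ : Form r} (hζ : ζ ∈ homForms r p m) :
    ζ ∈ formsOf (r := r) ⊤ p := by
  refine Submodule.span_induction ?_ (zero_mem _) (fun a b _ _ ha hb => add_mem ha hb)
    (fun c a _ ha => ?_) hζ
  · rintro _ ⟨e, f, α, -, -, hα, rfl⟩
    rw [mk_eq_smul]
    exact Submodule.smul_mem _ _ (mk_one_mem_formsOf hα)
  · exact Submodule.smul_of_tower_mem _ c ha

end Calculus

/-! ### The exterior derivative, the Euler field and homogeneous components -/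

section Derivative

variable {r : ℕ}

/-- The covector field of partial derivatives of `f`, so that `df = oneForm (grad f)`. -/
def grad : Poly r →ₗ[ℂ] (Fin (r + 1) → Poly r) :=
  LinearMap.pi fun i => (MvPolynomial.pderiv i).toLinearMap

theorem grad_apply (f : Poly r) (i : Fin (r + 1)) : grad f i = MvPolynomial.pderiv i f := rfl

theorem dPoly_eq_oneForm (f : Poly r) : dPoly f = oneForm (grad f) := by
  rw [dPoly_eq, oneForm_apply]
  rfl

theorem grad_mul (f g : Poly r) : grad (f * g) = f • grad g + g • grad f :=
  funext fun i => (MvPolynomial.pderiv i).leibniz f g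

theorem extD_mk (f : Poly r) (α : ConstForm r) :
    extD (Form.mk f α) = oneForm (grad f) * Form.mk 1 α := by
  simp [extD, Form.map_mk, oneForm_apply, Finset.sum_mul, Form.mk_mul_mk, grad_apply]

theorem grad_one : grad (1 : Poly r) = 0 := by
  funext i
  simp [grad_apply]

theorem extD_smul (f : Poly r) (ζ : Form r) :
    extD (f • ζ) = oneForm (grad f) * ζ + f • extD ζ := by
  induction ζ using Form.induction with
  | zero => simp
  | mk g α =>
    rw [smul_mk, extD_mk, extD_mk, grad_mul, map_add, map_smul, map_smul, add_mul, smul_mul_assoc,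
      smul_mul_assoc, mk_eq_smul g, mul_smul_comm]
    abel
  | add a b ha hb => rw [smul_add, map_add, ha, hb, map_add, smul_add, mul_add]; abel

theorem extD_mk_one (α : ConstForm r) : extD (Form.mk (1 : Poly r) α) = 0 := by
  rw [extD_mk, grad_one, map_zero, zero_mul]

theorem extD_smul_one (f : Poly r) : extD (f • (1 : Form r)) = oneForm (grad f) := by
  rw [extD_smul, ← Form.mk_one_one, extD_mk_one, smul_zero, add_zero, Form.mk_one_one, mul_one]

theorem oneForm_single (i : Fin (r + 1)) :
    oneForm (Pi.single i (1 : Poly r)) = Form.mk 1 (dx i) := by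
  simp [oneForm]

theorem extD_dx_mul (i : Fin (r + 1)) (ζ : Form r) :
    extD (Form.mk 1 (dx i) * ζ) = -(Form.mk 1 (dx i) * extD ζ) := by
  induction ζ using Form.induction with
  | zero => simp
  | mk g α =>
    rw [Form.mk_mul_mk, one_mul, extD_mk, extD_mk, ← oneForm_single, ← mul_assoc,
      oneForm_mul_comm _ (grad g), neg_mul, neg_neg, mul_assoc, oneForm_single, Form.mk_mul_mk,
      one_mul]
  | add a b ha hb => rw [mul_add, map_add, ha, hb, map_add, mul_add]; abel

theorem oneForm_eq_sum (a : Fin (r + 1) → Poly r) :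
    oneForm a = ∑ i, a i • Form.mk 1 (dx i) := Fintype.linearCombination_apply _ _ _

/-- The exterior derivative is an antiderivation. -/
theorem extD_oneForm_mul (a : Fin (r + 1) → Poly r) (ζ : Form r) :
    extD (oneForm a * ζ) = extD (oneForm a) * ζ - oneForm a * extD ζ := by
  simp only [oneForm_eq_sum a, Finset.sum_mul, map_sum, ← Finset.sum_sub_distrib]
  refine Finset.sum_congr rfl fun i _ => ?_
  rw [smul_mul_assoc, extD_smul, extD_dx_mul, extD_smul, extD_mk_one, smul_zero, add_zero,
    smul_neg, mul_assoc, smul_mul_assoc, sub_eq_add_neg]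

theorem pderiv_comm (i j : Fin (r + 1)) (f : Poly r) :
    MvPolynomial.pderiv i (MvPolynomial.pderiv j f) =
      MvPolynomial.pderiv j (MvPolynomial.pderiv i f) := by
  let p : Fin (r + 1) → Derivation ℂ (Poly r) (Poly r) := MvPolynomial.pderiv
  have h : ⁅p i, p j⁆ = 0 := by
    refine MvPolynomial.derivation_ext fun k => ?_
    simp only [p, Derivation.commutator_apply, MvPolynomial.pderiv_X]
    simp [Pi.single_apply, apply_ite]
  have h1 := congrArg (fun D : Derivation ℂ (Poly r) (Poly r) => D f) h
  simp only [Derivation.commutator_apply, Derivation.zero_apply] at h1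
  exact sub_eq_zero.mp h1

theorem extD_oneForm_grad (f : Poly r) : extD (oneForm (grad f)) = 0 := by
  have h : extD (oneForm (grad f)) = -extD (oneForm (grad f)) := by
    simp only [oneForm_apply, map_sum, extD_mk, Finset.sum_mul, Form.mk_mul_mk]
    conv_lhs => rw [Finset.sum_comm]
    rw [← Finset.sum_neg_distrib]
    refine Finset.sum_congr rfl fun i _ => ?_
    rw [← Finset.sum_neg_distrib]
    refine Finset.sum_congr rfl fun j _ => ?_
    rw [← map_neg, ← eq_neg_of_add_eq_zero_left (dx_mul_dx_add i j)]
    simp only [grad_apply, mul_one]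
    rw [pderiv_comm]
  have h2 : (2 : ℂ) • extD (oneForm (grad f)) = 0 := by
    rw [two_smul]
    exact eq_neg_iff_add_eq_zero.mp h
  exact (smul_eq_zero.mp h2).resolve_left two_ne_zero

theorem extD_oneForm_grad_mul (f : Poly r) (ζ : Form r) :
    extD (oneForm (grad f) * ζ) = -(oneForm (grad f) * extD ζ) := by
  rw [extD_oneForm_mul, extD_oneForm_grad, zero_mul, zero_sub]

theorem extD_extD (ζ : Form r) : extD (extD ζ) = 0 := by
  induction ζ using Form.induction with
  | zero => simp
  | mk f α => rw [extD_mk, extD_oneForm_grad_mul, extD_mk_one, mul_zero, neg_zero]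
  | add a b ha hb => rw [map_add, map_add, ha, hb, add_zero]

theorem extD_wedge_grad_mul {n : ℕ} (F : Fin n → Poly r) (ζ : Form r) :
    extD (wedge n (fun i => grad (F i)) * ζ) =
      (-1 : ℂ) ^ n • (wedge n (fun i => grad (F i)) * extD ζ) := by
  induction n with
  | zero => simp [wedge_zero]
  | succ n ih =>
    rw [wedge_succ, mul_assoc, extD_oneForm_grad_mul, ih, mul_smul_comm, mul_assoc, pow_succ,
      mul_neg_one, neg_smul]

theorem extD_wedge_grad {n : ℕ} (F : Fin n → Poly r) :
    extD (wedge n (fun i => grad (F i))) = 0 := by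
  have := extD_wedge_grad_mul F 1
  rwa [mul_one, ← Form.mk_one_one, extD_mk_one, mul_zero, smul_zero] at this

theorem X_dotProduct_grad {e : ℕ} {f : Poly r} (hf : f ∈ S r e) :
    (MvPolynomial.X ⬝ᵥ grad f : Poly r) = (e : ℂ) • f := by
  have := MvPolynomial.IsHomogeneous.sum_X_mul_pderiv (show f.IsHomogeneous e from hf)
  rw [dotProduct, Nat.cast_smul_eq_nsmul]
  exact this

theorem sum_dx_mul_contractVec {p : ℕ} {α : ConstForm r}
    (hα : α ∈ ⋀[ℂ]^p (Module.Dual ℂ (Vec r))) :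
    ∑ i, dx i * contractVec (Pi.single i 1) α = (p : ℂ) • α := by
  induction p generalizing α with
  | zero =>
    rw [ExteriorAlgebra.exteriorPower, pow_zero] at hα
    obtain ⟨c, rfl⟩ := Submodule.mem_one.mp hα
    simp [Algebra.algebraMap_eq_smul_one, contractVec_one]
  | succ p ih =>
    rw [ExteriorAlgebra.exteriorPower, pow_succ'] at hα
    refine Submodule.mul_induction_on hα ?_ (fun a b ha hb => by
      simp only [map_add, mul_add, Finset.sum_add_distrib, ha, hb, smul_add])
    rintro _ ⟨φ, rfl⟩ β hβ
    have h1 : ∀ v : Vec r, contractVec v (ExteriorAlgebra.ι ℂ φ * β) =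
        φ v • β - ExteriorAlgebra.ι ℂ φ * contractVec v β := fun v =>
      CliffordAlgebra.contractLeft_ι_mul
        (Q := (0 : QuadraticForm ℂ (Module.Dual ℂ (Vec r)))) (d := Module.Dual.eval ℂ (Vec r) v) φ β
    have h2 : (ExteriorAlgebra.ι ℂ φ : ConstForm r) = ∑ i, φ (Pi.single i 1) • dx i := by
      simp only [dx, ← map_smul, ← map_sum]
      congr 1
      refine LinearMap.pi_ext' fun i => LinearMap.ext_ring ?_
      simp [Pi.single_apply]
    have h3 : ∀ i, dx i * (ExteriorAlgebra.ι ℂ φ * contractVec (Pi.single i 1) β) =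
        -(ExteriorAlgebra.ι ℂ φ * (dx i * contractVec (Pi.single i 1) β)) := fun i => by
      rw [← mul_assoc, ← mul_assoc, ← neg_mul]
      congr 1
      exact eq_neg_of_add_eq_zero_left (ExteriorAlgebra.ι_add_mul_swap _ _)
    have h4 : ∑ i, φ (Pi.single i 1) • (dx i * β) = ExteriorAlgebra.ι ℂ φ * β := by
      rw [h2, Finset.sum_mul]
      exact Finset.sum_congr rfl fun i _ => (smul_mul_assoc _ _ _).symm
    simp only [h1, mul_sub, h3, mul_smul_comm, sub_neg_eq_add, Finset.sum_add_distrib,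
      ← Finset.mul_sum, ih hβ, h4]
    rw [Nat.cast_succ, add_smul, one_smul, add_comm]

/-- Cartan's formula for the Euler field: `i_R d + d i_R` multiplies a form by its total degree. -/
theorem iR_extD_add_extD_iR {q m : ℕ} {ζ : Form r} (hζ : ζ ∈ homForms r q m) :
    iR (extD ζ) + extD (iR ζ) = (m : ℂ) • ζ := by
  refine Submodule.span_induction ?_ (by simp) (fun a b _ _ ha hb => ?_) (fun c a _ ha => ?_) hζ
  · rintro _ ⟨e, f, α, he, hf, hα, rfl⟩
    have h1 : iR (Form.mk f α) = f • contract MvPolynomial.X (Form.mk 1 α) := by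
      rw [iR_eq_contract, mk_eq_smul, map_smul]
    have h2 : extD (contract MvPolynomial.X (Form.mk (1 : Poly r) α)) =
        (q : ℂ) • Form.mk 1 α := by
      rw [← map_smul, ← sum_dx_mul_contractVec hα, contract_apply, map_sum, map_sum]
      refine Finset.sum_congr rfl fun i _ => ?_
      rw [extD_smul, contractConst_mk, extD_mk_one, smul_zero, add_zero]
      have : grad (MvPolynomial.X i : Poly r) = Pi.single i 1 := by
        funext j
        rw [grad_apply, MvPolynomial.pderiv_X]
        simp [Pi.single_apply, eq_comm]
      rw [this, oneForm_single, Form.mk_mul_mk, one_mul]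
    rw [extD_mk, iR_eq_contract, contract_oneForm_mul, X_dotProduct_grad hf, h1, extD_smul, h2,
      mk_eq_smul f, ← he, smul_assoc, Nat.cast_add, add_smul, smul_comm f]
    abel
  · rw [map_add, map_add, map_add, map_add, smul_add, ← ha, ← hb]; abel
  · rw [map_smul, map_smul, map_smul, map_smul, ← smul_add, ha, smul_comm]

theorem extD_mem_homForms {q m : ℕ} {ζ : Form r} (hζ : ζ ∈ homForms r q m) :
    extD ζ ∈ homForms r (q + 1) m := by
  refine Submodule.span_induction ?_ (by simp) (fun a b _ _ ha hb => ?_) (fun c a _ ha => ?_) hζ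
  · rintro _ ⟨e, f, α, he, hf, hα, rfl⟩
    have h1 : Form.mk 1 α ∈ homForms r q q :=
      mk_mem_homForms (e := 0) (by omega) (MvPolynomial.isHomogeneous_one _ _) hα
    rw [extD_mk, ← dPoly_eq_oneForm, add_comm, ← he]
    exact mul_mem_homForms (dPoly_mem hf) h1
  · rw [map_add]; exact add_mem ha hb
  · rw [map_smul]; exact Submodule.smul_mem _ _ ha

theorem wedge_mem_homForms {n : ℕ} {θ : Fin n → Fin (r + 1) → Poly r} {d : Fin n → ℕ}
    (h : ∀ i, oneForm (θ i) ∈ homForms r 1 (d i)) : wedge n θ ∈ homForms r n (∑ i, d i) := by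
  rw [wedge_apply]
  exact list_prod_mem_homForms n d _ h

theorem oneForm_mem_homForms {k : ℕ} {a : Fin (r + 1) → Poly r} (h : ∀ i, a i ∈ S r k) :
    oneForm a ∈ homForms r 1 (k + 1) := by
  rw [oneForm_apply]
  refine sum_mem fun i _ => mk_mem_homForms rfl (h i) ?_
  rw [ExteriorAlgebra.exteriorPower, pow_one]
  exact ⟨_, rfl⟩

/-- The part of a form whose coefficients are homogeneous of degree `k`. -/
def coeffComponent (k : ℕ) : Form r →ₗ[ℂ] Form r :=
  Form.map (MvPolynomial.homogeneousComponent k) LinearMap.id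

theorem coeffComponent_mk (k : ℕ) (f : Poly r) (α : ConstForm r) :
    coeffComponent k (Form.mk f α) = Form.mk (MvPolynomial.homogeneousComponent k f) α :=
  Form.map_mk _ _ _ _

theorem homogeneousComponent_mul {e : ℕ} {f : Poly r} (hf : f ∈ S r e) (g : Poly r) (b : ℕ) :
    MvPolynomial.homogeneousComponent (e + b) (f * g) =
      f * MvPolynomial.homogeneousComponent b g := by
  have hg := MvPolynomial.sum_homogeneousComponent g
  conv_lhs => rw [← hg]
  rw [Finset.mul_sum, map_sum]
  have h : ∀ i, MvPolynomial.homogeneousComponent (e + b)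
      (f * MvPolynomial.homogeneousComponent i g) =
        if i = b then f * MvPolynomial.homogeneousComponent i g else 0 := fun i => by
    have h1 : f * MvPolynomial.homogeneousComponent i g ∈ S r (e + i) :=
      MvPolynomial.IsHomogeneous.mul hf (MvPolynomial.homogeneousComponent_isHomogeneous i g)
    rw [MvPolynomial.homogeneousComponent_of_mem h1]
    simp [eq_comm]
  simp only [h, Finset.sum_ite_eq', Finset.mem_range]
  split_ifs with hb
  · rfl
  · rw [MvPolynomial.homogeneousComponent_eq_zero _ _ (by omega), mul_zero]

theorem homogeneousComponent_mul_eq_zero {e k : ℕ} {f : Poly r} (hf : f ∈ S r e) (g : Poly r)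
    (hk : k < e) : MvPolynomial.homogeneousComponent k (f * g) = 0 := by
  have hg := MvPolynomial.sum_homogeneousComponent g
  conv_lhs => rw [← hg]
  rw [Finset.mul_sum, map_sum]
  refine Finset.sum_eq_zero fun i _ => ?_
  have h1 : f * MvPolynomial.homogeneousComponent i g ∈ S r (e + i) :=
    MvPolynomial.IsHomogeneous.mul hf (MvPolynomial.homogeneousComponent_isHomogeneous i g)
  rw [MvPolynomial.homogeneousComponent_of_mem h1, if_neg (by omega)]

theorem coeffComponent_mul {p e b : ℕ} {ζ : Form r} (hζ : ζ ∈ homForms r p (e + p)) (ξ : Form r) :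
    coeffComponent (e + b) (ζ * ξ) = ζ * coeffComponent b ξ := by
  refine Submodule.span_induction ?_ (by simp) (fun a b _ _ ha hb => ?_) (fun c a _ ha => ?_) hζ
  · rintro _ ⟨e', f, α, he, hf, hα, rfl⟩
    obtain rfl : e' = e := by omega
    induction ξ using Form.induction with
    | zero => simp
    | mk g β =>
      rw [Form.mk_mul_mk, coeffComponent_mk, coeffComponent_mk, Form.mk_mul_mk,
        homogeneousComponent_mul hf]
    | add a b ha hb => rw [mul_add, map_add, ha, hb, map_add, mul_add]
  · rw [add_mul, map_add, ha, hb, add_mul]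
  · rw [smul_mul_assoc, map_smul, ha, smul_mul_assoc]

theorem coeffComponent_mul_eq_zero {p e k : ℕ} {ζ : Form r} (hζ : ζ ∈ homForms r p (e + p))
    (ξ : Form r) (hk : k < e) : coeffComponent k (ζ * ξ) = 0 := by
  refine Submodule.span_induction ?_ (by simp) (fun a b _ _ ha hb => ?_) (fun c a _ ha => ?_) hζ
  · rintro _ ⟨e', f, α, he, hf, hα, rfl⟩
    obtain rfl : e' = e := by omega
    induction ξ using Form.induction with
    | zero => simp
    | mk g β =>
      rw [Form.mk_mul_mk, coeffComponent_mk, homogeneousComponent_mul_eq_zero hf _ hk, map_zero,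
        LinearMap.zero_apply]
    | add a b ha hb => rw [mul_add, map_add, ha, hb, add_zero]
  · rw [add_mul, map_add, ha, hb, add_zero]
  · rw [smul_mul_assoc, map_smul, ha, smul_zero]

theorem coeffComponent_oneForm (k : ℕ) (a : Fin (r + 1) → Poly r) :
    coeffComponent k (oneForm a) =
      oneForm fun i => MvPolynomial.homogeneousComponent k (a i) := by
  rw [oneForm_apply, oneForm_apply, map_sum]
  exact Finset.sum_congr rfl fun i _ => coeffComponent_mk _ _ _

theorem coeffComponent_smul_one (k : ℕ) (f : Poly r) :
    coeffComponent k (f • (1 : Form r)) = MvPolynomial.homogeneousComponent k f • 1 := by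
  rw [← Form.mk_one_one, ← mk_eq_smul, ← mk_eq_smul, coeffComponent_mk]

theorem coeffComponent_self {p e : ℕ} {ζ : Form r} (hζ : ζ ∈ homForms r p (e + p)) :
    coeffComponent e ζ = ζ := by
  have h := coeffComponent_mul (b := 0) hζ 1
  have h1 : coeffComponent 0 (1 : Form r) = 1 := by
    have := coeffComponent_smul_one 0 (1 : Poly r)
    rw [one_smul] at this
    rw [this, MvPolynomial.homogeneousComponent_zero]
    simp
  rwa [mul_one, add_zero, h1, mul_one] at h

end Derivative

/-! ### Division by a family of covector fields -/

section Division

variable {r n : ℕ} {θ w : Fin n → Fin (r + 1) → Poly r} {D : Poly r}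

/-- The vector fields `w_j` are dual to the covector fields `θ_i` up to the factor `D`. -/
def IsDualFamily (θ w : Fin n → Fin (r + 1) → Poly r) (D : Poly r) : Prop :=
  ∀ j i, w j ⬝ᵥ θ i = if j = i then D else 0

theorem IsDualFamily.tail {θ w : Fin (n + 1) → Fin (r + 1) → Poly r} (h : IsDualFamily θ w D) :
    IsDualFamily (fun i => θ i.succ) (fun i => w i.succ) D := fun j i => by
  rw [h j.succ i.succ]
  simp

theorem contract_wedge_eq_zero {u : Fin (r + 1) → Poly r} (h : ∀ i, u ⬝ᵥ θ i = 0) :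
    contract u (wedge n θ) = 0 := by
  induction n with
  | zero => rw [wedge_zero, contract_one]
  | succ n ih =>
    rw [wedge_succ, contract_oneForm_mul, h, zero_smul, ih fun i => h i.succ, mul_zero, sub_zero]

theorem IsDualFamily.wedge_ne_zero (h : IsDualFamily θ w D) (hD : D ≠ 0) : wedge n θ ≠ 0 := by
  induction n with
  | zero =>
    rw [wedge_zero]
    exact fun h0 => one_ne_zero (smul_one_injective (r := r) (f := 1) (by rw [one_smul, h0]))
  | succ n ih =>
    intro h0
    refine ih h.tail (form_smul_eq_zero hD ?_)
    have h1 := congrArg (contract (w 0)) h0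
    rw [wedge_succ, contract_oneForm_mul, h 0 0, if_pos rfl, map_zero,
      contract_wedge_eq_zero fun i => by rw [h 0 i.succ, if_neg (Fin.succ_ne_zero i).symm],
      mul_zero, sub_zero] at h1
    exact h1

/-- Where the `θ_i` are independent, a form killed by their product lies in the ideal they
generate. -/
theorem IsDualFamily.exists_of_wedge_mul_eq_zero (h : IsDualFamily θ w D) {p : ℕ} {ζ : Form r}
    (hζ : ζ ∈ formsOf ⊤ (p + 1)) (h0 : wedge n θ * ζ = 0) :
    ∃ β : Fin n → Form r, (∀ j, β j ∈ formsOf ⊤ p) ∧ D ^ n • ζ = ∑ j, oneForm (θ j) * β j := by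
  induction n generalizing p ζ with
  | zero =>
    rw [wedge_zero, one_mul] at h0
    exact ⟨Fin.elim0, fun j => j.elim0, by simp [h0]⟩
  | succ n ih =>
    have h1 : wedge n (fun i => θ i.succ) * (oneForm (θ 0) * ζ) = 0 := by
      rw [wedge_succ, oneForm_mul_comm_of_mem (wedge_mem_formsOf (U := ⊤) fun _ => Submodule.mem_top),
        smul_mul_assoc, mul_assoc] at h0
      exact (smul_eq_zero.mp h0).resolve_left (pow_ne_zero _ (neg_ne_zero.mpr one_ne_zero))
    obtain ⟨β, hβ, hsum⟩ := ih h.tail (oneForm_mul_mem Submodule.mem_top hζ) h1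
    refine ⟨Fin.cons (D ^ n • contract (w 0) ζ) fun j => -contract (w 0) (β j), ?_, ?_⟩
    · refine Fin.cases ?_ fun j => ?_
      · exact Submodule.smul_mem _ _ (contract_mem_formsOf _ hζ)
      · exact neg_mem (contract_mem_formsOf _ (hβ j))
    · have h2 := congrArg (contract (w 0)) hsum
      have h3 : ∀ j : Fin n, contract (w 0) (oneForm (θ j.succ) * β j) =
          oneForm (θ j.succ) * -contract (w 0) (β j) := fun j => by
        rw [contract_oneForm_mul, h 0 j.succ, if_neg (Fin.succ_ne_zero j).symm, zero_smul, zero_sub,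
          mul_neg]
      rw [map_smul, contract_oneForm_mul, h 0 0, if_pos rfl, map_sum,
        Finset.sum_congr rfl fun j _ => h3 j, smul_sub, smul_smul, ← pow_succ,
        sub_eq_iff_eq_add] at h2
      rw [Fin.sum_univ_succ, Fin.cons_zero, mul_smul_comm, h2, add_comm]
      rfl

/-- Where the `θ_i` are independent, a form killed by each of them is divisible by their
product. -/
theorem IsDualFamily.exists_of_oneForm_mul_eq_zero (h : IsDualFamily θ w D) {p : ℕ} {ξ : Form r}
    (hξ : ξ ∈ formsOf ⊤ (n + p)) (h0 : ∀ j, oneForm (θ j) * ξ = 0) :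
    ∃ β ∈ formsOf ⊤ p, D ^ n • ξ = wedge n θ * β := by
  induction n generalizing ξ with
  | zero => exact ⟨ξ, by rwa [zero_add] at hξ, by rw [pow_zero, one_smul, wedge_zero, one_mul]⟩
  | succ n ih =>
    rw [show n + 1 + p = (n + p) + 1 by omega] at hξ
    have h1 : ∀ j : Fin n, oneForm (θ j.succ) * contract (w 0) ξ = 0 := fun j => by
      have h2 := congrArg (contract (w 0)) (h0 j.succ)
      rw [contract_oneForm_mul, h 0 j.succ, if_neg (Fin.succ_ne_zero j).symm, zero_smul, zero_sub,
        map_zero, neg_eq_zero] at h2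
      exact h2
    obtain ⟨β, hβ, hβe⟩ := ih h.tail (contract_mem_formsOf _ hξ) h1
    refine ⟨β, hβ, ?_⟩
    have h2 := congrArg (contract (w 0)) (h0 0)
    rw [contract_oneForm_mul, h 0 0, if_pos rfl, map_zero, sub_eq_zero] at h2
    rw [pow_succ, mul_smul, h2, ← mul_smul_comm, hβe, wedge_succ, mul_assoc]

/-- The ideal generated by the powers `D ^ (n + 1)` of the factors `D` up to which the `θ_i` have a
dual family. Away from its zero locus the `θ_i` are independent, and the exponent makes its
elements clear the denominators that occur in division by the `θ_i`. -/
def dualIdeal (θ : Fin n → Fin (r + 1) → Poly r) : Ideal (Poly r) :=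
  Ideal.span {a | ∃ w D, IsDualFamily θ w D ∧ a = D ^ (n + 1)}

/-- The locus where the `θ_i` are dependent has codimension at least three, in the form in which
this is used. -/
def HasDepthThree (θ : Fin n → Fin (r + 1) → Poly r) : Prop :=
  ∃ f ∈ dualIdeal θ, ∃ g ∈ dualIdeal θ, ∃ h ∈ dualIdeal θ, IsRegularTriple f g h

theorem smul_mem_of_mem_dualIdeal {N : Submodule (Poly r) (Form r)} {ζ : Form r}
    (H : ∀ w D, IsDualFamily θ w D → D ^ n • ζ ∈ N) {a : Poly r} (ha : a ∈ dualIdeal θ) :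
    a • ζ ∈ N := by
  refine Submodule.span_induction ?_ (by simp) (fun a b _ _ ha hb => ?_) (fun c a _ ha => ?_) ha
  · rintro _ ⟨w, D, hw, rfl⟩
    rw [pow_succ', mul_smul]
    exact N.smul_mem _ (H w D hw)
  · rw [add_smul]; exact add_mem ha hb
  · rw [smul_assoc]; exact N.smul_mem _ ha

theorem IsRegularTriple.ne_zero {f g h : Poly r} (H : IsRegularTriple f g h) : f ≠ 0 := by
  rintro rfl
  exact one_ne_zero (H.fst (x := 1) (zero_mul _))

theorem HasDepthThree.exists_dual (h : HasDepthThree θ) : ∃ w D, IsDualFamily θ w D ∧ D ≠ 0 := by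
  obtain ⟨f, hf, g, -, k, -, H⟩ := h
  by_contra! h0
  refine H.ne_zero (Ideal.mem_bot.mp ((Ideal.span_le.mpr ?_ : dualIdeal θ ≤ ⊥) hf))
  rintro _ ⟨w, D, hw, rfl⟩
  rw [h0 w D hw]
  simp

/-- The covector field `∑ j, c_j θ_j`. -/
def combination (θ : Fin n → Fin (r + 1) → Poly r) :
    (Fin n → Poly r) →ₗ[Poly r] (Fin (r + 1) → Poly r) :=
  Fintype.linearCombination (Poly r) θ

theorem combination_apply (c : Fin n → Poly r) : combination θ c = ∑ j, c j • θ j :=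
  Fintype.linearCombination_apply _ _ _

theorem IsDualFamily.dotProduct_combination (h : IsDualFamily θ w D) (j : Fin n)
    (c : Fin n → Poly r) : w j ⬝ᵥ combination θ c = D * c j := by
  rw [combination_apply, dotProduct_sum, Finset.sum_eq_single j]
  · rw [dotProduct_smul, h j j, if_pos rfl, smul_eq_mul, mul_comm]
  · intro i _ hi
    rw [dotProduct_smul, h j i, if_neg hi.symm, smul_zero]
  · simp

theorem HasDepthThree.combination_injective (h : HasDepthThree θ) :
    Function.Injective (combination θ) := by
  obtain ⟨w, D, hw, hD⟩ := h.exists_dual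
  refine (injective_iff_map_eq_zero _).mpr fun c hc => funext fun j => ?_
  have := hw.dotProduct_combination j c
  rw [hc, dotProduct_zero] at this
  exact (mul_eq_zero.mp this.symm).resolve_left hD

theorem oneForm_combination (c : Fin n → Poly r) :
    oneForm (combination θ c) = ∑ j, oneForm (θ j) * (c j • 1) := by
  rw [combination_apply, map_sum]
  exact Finset.sum_congr rfl fun j _ => by rw [map_smul, mul_smul_comm, mul_one]

theorem wedge_mul_oneForm_self (j : Fin n) : wedge n θ * oneForm (θ j) = 0 := by
  have h := oneForm_mul_comm_of_mem (wedge_mem_formsOf (U := ⊤) (θ := θ) fun _ => Submodule.mem_top)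
    (θ j)
  rw [oneForm_mul_wedge_self] at h
  exact (smul_eq_zero.mp h.symm).resolve_left (pow_ne_zero _ (neg_ne_zero.mpr one_ne_zero))

theorem wedge_mul_combination (c : Fin n → Poly r) :
    wedge n θ * oneForm (combination θ c) = 0 := by
  rw [oneForm_combination, Finset.mul_sum]
  exact Finset.sum_eq_zero fun j _ => by
    rw [← mul_assoc, wedge_mul_oneForm_self, zero_mul]

theorem HasDepthThree.mem_range_combination (h : HasDepthThree θ) {α : Fin (r + 1) → Poly r}
    (H : ∀ w D, IsDualFamily θ w D →
      D ^ n • oneForm α ∈ LinearMap.range (oneForm ∘ₗ combination θ)) :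
    ∃ c, α = combination θ c := by
  obtain ⟨f, hf, g, hg, k, -, hreg⟩ := id h
  obtain ⟨c, hc⟩ := hreg.mem_range_of_injective (ξ := oneForm α)
    (fun m hm => form_smul_eq_zero hreg.ne_zero hm) (oneForm ∘ₗ combination θ)
    (oneForm_injective.comp h.combination_injective) (smul_mem_of_mem_dualIdeal H hf)
    (smul_mem_of_mem_dualIdeal H hg)
  exact ⟨c, (oneForm_injective hc).symm⟩

/-- Division of `1`-forms. -/
theorem HasDepthThree.exists_of_wedge_mul_oneForm (h : HasDepthThree θ)
    {α : Fin (r + 1) → Poly r} (h0 : wedge n θ * oneForm α = 0) : ∃ c, α = combination θ c := by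
  refine h.mem_range_combination fun w D hw => ?_
  obtain ⟨β, hβ, hsum⟩ := hw.exists_of_wedge_mul_eq_zero (p := 0)
    (oneForm_mem_formsOf Submodule.mem_top) h0
  choose c hc using fun j => mem_formsOf_zero.mp (hβ j)
  exact ⟨c, by rw [hsum, LinearMap.comp_apply, oneForm_combination]; simp only [hc]⟩

/-- The map `(β_j) ↦ ∑ j, θ_j ∧ β_j` on families of covector fields. -/
def twoFormMap (θ : Fin n → Fin (r + 1) → Poly r) :
    (Fin n × Fin (r + 1) → Poly r) →ₗ[Poly r] Form r where
  toFun b := ∑ j, oneForm (θ j) * oneForm fun i => b (j, i)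
  map_add' b b' := by
    rw [← Finset.sum_add_distrib]
    exact Finset.sum_congr rfl fun j _ => by rw [← mul_add, ← map_add]; rfl
  map_smul' c b := by
    rw [RingHom.id_apply, Finset.smul_sum]
    exact Finset.sum_congr rfl fun j _ => by rw [← mul_smul_comm, ← map_smul]; rfl

/-- The map that takes a symmetric matrix `s` to the relation `∑ j, θ_j ∧ (∑ k, s_jk θ_k) = 0`.
A symmetric matrix is given as a function on unordered pairs. -/
def symmetricMap (θ : Fin n → Fin (r + 1) → Poly r) :
    (Sym2 (Fin n) → Poly r) →ₗ[Poly r] (Fin n × Fin (r + 1) → Poly r) where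
  toFun s ji := combination θ (fun k => s s(ji.1, k)) ji.2
  map_add' s s' := funext fun ji => congrFun
    ((combination θ).map_add (fun k => s s(ji.1, k)) (fun k => s' s(ji.1, k))) ji.2
  map_smul' c s := funext fun ji => congrFun
    ((combination θ).map_smul c (fun k => s s(ji.1, k))) ji.2

theorem twoFormMap_symmetricMap (s : Sym2 (Fin n) → Poly r) :
    twoFormMap θ (symmetricMap θ s) = 0 := by
  have h1 : twoFormMap θ (symmetricMap θ s) =
      ∑ j, ∑ k, s s(j, k) • (oneForm (θ j) * oneForm (θ k)) := by
    have h0 : twoFormMap θ (symmetricMap θ s) =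
      ∑ j, oneForm (θ j) * oneForm fun i => symmetricMap θ s (j, i) := rfl
    rw [h0]
    refine Finset.sum_congr rfl fun j _ => ?_
    have : (fun i => symmetricMap θ s (j, i)) = combination θ fun k => s s(j, k) := rfl
    rw [this, combination_apply, map_sum, Finset.mul_sum]
    exact Finset.sum_congr rfl fun k _ => by rw [map_smul, mul_smul_comm]
  have h2 : twoFormMap θ (symmetricMap θ s) = -twoFormMap θ (symmetricMap θ s) := by
    rw [h1]
    conv_lhs => rw [Finset.sum_comm]
    rw [← Finset.sum_neg_distrib]
    refine Finset.sum_congr rfl fun j _ => ?_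
    rw [← Finset.sum_neg_distrib]
    refine Finset.sum_congr rfl fun k _ => ?_
    rw [Sym2.eq_swap, oneForm_mul_comm, smul_neg]
  have h3 : (2 : ℂ) • twoFormMap θ (symmetricMap θ s) = 0 := by
    rw [two_smul]
    exact eq_neg_iff_add_eq_zero.mp h2
  exact (smul_eq_zero.mp h3).resolve_left two_ne_zero

theorem HasDepthThree.symmetricMap_injective (h : HasDepthThree θ) :
    Function.Injective (symmetricMap θ) := by
  refine (injective_iff_map_eq_zero _).mpr fun s hs => funext fun e => ?_
  induction e using Sym2.ind with
  | _ j k =>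
    have h1 : combination θ (fun k => s s(j, k)) = 0 := funext fun i => congrFun hs (j, i)
    exact congrFun (h.combination_injective (h1.trans (combination θ).map_zero.symm)) k

/-- The relations between the `θ_j` in degree two are the symmetric ones. -/
theorem HasDepthThree.mem_range_symmetricMap (h : HasDepthThree θ)
    {b : Fin n × Fin (r + 1) → Poly r} (hb : twoFormMap θ b = 0) :
    b ∈ LinearMap.range (symmetricMap θ) := by
  let β : Fin n → Fin (r + 1) → Poly r := fun j i => b (j, i)
  have hb' : ∑ j, oneForm (θ j) * oneForm (β j) = 0 := hb
  -- Contracting the relation with `w_k` expresses `D β_k` by the `θ_j`.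
  have key : ∀ w D, IsDualFamily θ w D → ∀ k,
      D • β k = combination θ fun j => w k ⬝ᵥ β j := by
    intro w D hw k
    have h1 := congrArg (contract (w k)) hb'
    have h2 : ∀ j, contract (w k) (oneForm (θ j) * oneForm (β j)) =
        (if k = j then D else 0) • oneForm (β j) - oneForm (θ j) * ((w k ⬝ᵥ β j) • 1) := fun j => by
      rw [contract_oneForm_mul, hw k j, contract_oneForm]
    rw [map_sum, map_zero, Finset.sum_congr rfl fun j _ => h2 j, Finset.sum_sub_distrib,
      ← oneForm_combination (fun j => w k ⬝ᵥ β j), sub_eq_zero] at h1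
    refine oneForm_injective ?_
    rw [← h1, map_smul, Finset.sum_eq_single k]
    · rw [if_pos rfl]
    · intro j _ hj
      rw [if_neg hj.symm, zero_smul]
    · simp
  have hc : ∀ k, ∃ c, β k = combination θ c := fun k => by
    obtain ⟨f, hf, g, hg, l, -, hreg⟩ := id h
    have H : ∀ a ∈ dualIdeal θ, a • oneForm (β k) ∈ LinearMap.range (oneForm ∘ₗ combination θ) := by
      intro a ha
      refine Submodule.span_induction ?_ (by simp) (fun a b _ _ ha hb => ?_)
        (fun c a _ ha => ?_) ha
      · rintro _ ⟨w, D, hw, rfl⟩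
        rw [pow_succ, mul_smul, ← map_smul oneForm D, key w D hw k]
        exact Submodule.smul_mem _ _ ⟨_, rfl⟩
      · rw [add_smul]; exact add_mem ha hb
      · rw [smul_assoc]; exact Submodule.smul_mem _ _ ha
    obtain ⟨c, hc⟩ := hreg.mem_range_of_injective (ξ := oneForm (β k))
      (fun m hm => form_smul_eq_zero hreg.ne_zero hm) (oneForm ∘ₗ combination θ)
      (oneForm_injective.comp h.combination_injective) (H f hf) (H g hg)
    exact ⟨c, (oneForm_injective hc).symm⟩
  choose c hc using hc
  obtain ⟨w, D, hw, hD⟩ := h.exists_dual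
  -- The coefficient `c_jk` is `w_k ⬝ β_j` up to the factor `D`; pair `key` for `j` with `w_k`.
  have hsymm : ∀ j k, c j k = c k j := fun j k => by
    have h1 : w k ⬝ᵥ β j = w j ⬝ᵥ β k := by
      have h2 := congrArg (fun a => w k ⬝ᵥ a) (key w D hw j)
      simp only [dotProduct_smul, hw.dotProduct_combination, smul_eq_mul] at h2
      exact mul_left_cancel₀ hD h2
    rw [hc j, hc k, hw.dotProduct_combination, hw.dotProduct_combination] at h1
    exact mul_left_cancel₀ hD h1
  refine ⟨Sym2.lift ⟨c, hsymm⟩, funext fun ji => ?_⟩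
  exact (congrFun (hc ji.1) ji.2).symm

/-- Division of `2`-forms. This uses that the codimension is at least three. -/
theorem HasDepthThree.exists_of_wedge_mul_twoForm (h : HasDepthThree θ) {ζ : Form r}
    (hζ : ζ ∈ formsOf ⊤ 2) (h0 : wedge n θ * ζ = 0) :
    ∃ β : Fin n → Fin (r + 1) → Poly r, ζ = ∑ j, oneForm (θ j) * oneForm (β j) := by
  obtain ⟨f, hf, g, hg, k, hk, hreg⟩ := id h
  have H : ∀ w D, IsDualFamily θ w D → D ^ n • ζ ∈ LinearMap.range (twoFormMap θ) := by
    intro w D hw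
    obtain ⟨β, hβ, hsum⟩ := hw.exists_of_wedge_mul_eq_zero (p := 1) hζ h0
    choose b _ hb using fun j => mem_formsOf_one.mp (hβ j)
    refine ⟨fun ji => b ji.1 ji.2, ?_⟩
    rw [hsum]
    simp only [← hb]
    rfl
  obtain ⟨b, hb⟩ := hreg.mem_range_of_exact
    (fun m hm => form_smul_eq_zero hreg.ne_zero hm) (symmetricMap θ) h.symmetricMap_injective
    (twoFormMap θ) (fun _ => h.mem_range_symmetricMap) twoFormMap_symmetricMap
    (smul_mem_of_mem_dualIdeal H hf) (smul_mem_of_mem_dualIdeal H hg)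
    (smul_mem_of_mem_dualIdeal H hk)
  exact ⟨fun j i => b (j, i), hb.symm⟩

/-- An `(n + 1)`-form that is killed by all `θ_j` is divisible by their product. This uses that
the codimension is at least three. -/
theorem HasDepthThree.exists_eq_wedge_mul_oneForm (h : HasDepthThree θ) {ξ : Form r}
    (hξ : ξ ∈ formsOf ⊤ (n + 1)) (h0 : ∀ j, oneForm (θ j) * ξ = 0) :
    ∃ α, ξ = wedge n θ * oneForm α := by
  obtain ⟨f, hf, g, hg, k, hk, hreg⟩ := id h
  have H : ∀ w D, IsDualFamily θ w D →
      D ^ n • ξ ∈ LinearMap.range (LinearMap.mulLeft (Poly r) (wedge n θ) ∘ₗ oneForm) := by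
    intro w D hw
    obtain ⟨β, hβ, hsum⟩ := hw.exists_of_oneForm_mul_eq_zero hξ h0
    obtain ⟨b, -, rfl⟩ := mem_formsOf_one.mp hβ
    exact ⟨b, hsum.symm⟩
  obtain ⟨α, hα⟩ := hreg.mem_range_of_exact
    (fun m hm => form_smul_eq_zero hreg.ne_zero hm) (combination θ) h.combination_injective
    (LinearMap.mulLeft (Poly r) (wedge n θ) ∘ₗ oneForm)
    (fun a ha => (h.exists_of_wedge_mul_oneForm ha).imp fun _ => Eq.symm) wedge_mul_combination
    (smul_mem_of_mem_dualIdeal H hf) (smul_mem_of_mem_dualIdeal H hg)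
    (smul_mem_of_mem_dualIdeal H hk)
  exact ⟨α, hα.symm⟩

/-- An `n`-form that is killed by all `θ_j` is a multiple of their product. -/
theorem HasDepthThree.exists_eq_smul_wedge (h : HasDepthThree θ) {ξ : Form r}
    (hξ : ξ ∈ formsOf ⊤ n) (h0 : ∀ j, oneForm (θ j) * ξ = 0) :
    ∃ c : Poly r, ξ = c • wedge n θ := by
  obtain ⟨f, hf, g, hg, k, hk, hreg⟩ := id h
  obtain ⟨w, D, hw, hD⟩ := h.exists_dual
  let Φ : (Unit → Poly r) →ₗ[Poly r] Form r :=
    LinearMap.toSpanSingleton (Poly r) (Form r) (wedge n θ) ∘ₗ LinearMap.proj ()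
  have hΦ : Function.Injective Φ := by
    refine (injective_iff_map_eq_zero _).mpr fun c hc => funext fun _ => ?_
    exact (smul_eq_zero.mp hc).resolve_right (hw.wedge_ne_zero hD)
  have H : ∀ w D, IsDualFamily θ w D → D ^ n • ξ ∈ LinearMap.range Φ := by
    intro w D hw
    obtain ⟨β, hβ, hsum⟩ := hw.exists_of_oneForm_mul_eq_zero (p := 0) hξ h0
    obtain ⟨c, rfl⟩ := mem_formsOf_zero.mp hβ
    refine ⟨fun _ => c, ?_⟩
    rw [hsum, mul_smul_comm, mul_one]
    rfl
  obtain ⟨c, hc⟩ := hreg.mem_range_of_injective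
    (fun m hm => form_smul_eq_zero hreg.ne_zero hm) Φ hΦ
    (smul_mem_of_mem_dualIdeal H hf) (smul_mem_of_mem_dualIdeal H hg)
  exact ⟨c (), hc.symm⟩

end Division

/-! ### Independence off the singular set -/

section Evaluation

variable {r n : ℕ}

theorem evalAt_mk (x : Vec r) (f : Poly r) (α : ConstForm r) :
    evalAt x (Form.mk f α) = MvPolynomial.aeval x f • α := by
  simp [evalAt, Form.mk]

theorem evalAt_mul (x : Vec r) (ζ ξ : Form r) : evalAt x (ζ * ξ) = evalAt x ζ * evalAt x ξ := by
  induction ζ using Form.induction with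
  | zero => simp
  | mk f α =>
    induction ξ using Form.induction with
    | zero => simp
    | mk g β => rw [Form.mk_mul_mk, evalAt_mk, evalAt_mk, evalAt_mk, map_mul, smul_mul_smul_comm]
    | add a b ha hb => rw [mul_add, map_add, ha, hb, map_add, mul_add]
  | add a b ha hb => rw [add_mul, map_add, ha, hb, map_add, add_mul]

/-- The linear form on `ℂ^{r+1}` with the given coefficients. -/
def covector : (Fin (r + 1) → ℂ) →ₗ[ℂ] Module.Dual ℂ (Vec r) :=
  Fintype.linearCombination ℂ fun i => (LinearMap.proj i : Module.Dual ℂ (Vec r))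

theorem evalAt_oneForm (x : Vec r) (a : Fin (r + 1) → Poly r) :
    evalAt x (oneForm a) =
      ExteriorAlgebra.ι ℂ (covector fun i => MvPolynomial.aeval x (a i)) := by
  rw [oneForm_apply, map_sum, covector, Fintype.linearCombination_apply, map_sum]
  exact Finset.sum_congr rfl fun i _ => by rw [evalAt_mk, dx, map_smul]

theorem evalAt_wedge (x : Vec r) (θ : Fin n → Fin (r + 1) → Poly r) :
    evalAt x (wedge n θ) = ((ExteriorAlgebra.ιMulti ℂ n).compLinearMap covector)
      fun i k => MvPolynomial.aeval x (θ i k) := by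
  rw [AlternatingMap.compLinearMap_apply, ExteriorAlgebra.ιMulti_apply]
  induction n with
  | zero => rw [wedge_zero, ← Form.mk_one_one, evalAt_mk]; simp
  | succ n ih =>
    rw [wedge_succ, evalAt_mul, ih, evalAt_oneForm, List.ofFn_succ, List.prod_cons]

/-- At a point where the product of the `θ_i` does not vanish, they have a dual family up to a
factor that does not vanish there. -/
theorem exists_isDualFamily_of_evalAt_ne_zero {x : Vec r} {θ : Fin n → Fin (r + 1) → Poly r}
    (h : evalAt x (wedge n θ) ≠ 0) :
    ∃ w D, IsDualFamily θ w D ∧ MvPolynomial.aeval x D = 1 := by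
  let Θ : Matrix (Fin n) (Fin (r + 1)) (Poly r) := Matrix.of θ
  let ev : Poly r →+* ℂ := (MvPolynomial.aeval x : Poly r →ₐ[ℂ] ℂ).toRingHom
  let M : Matrix (Fin n) (Fin (r + 1)) ℂ := Θ.map ev
  have hind : LinearIndependent ℂ M.row := by
    by_contra hdep
    exact h ((evalAt_wedge x θ).trans (AlternatingMap.map_linearDependent _ _ hdep))
  have hsurj : Function.Surjective M.mulVec := by
    have h1 : LinearMap.range M.mulVecLin = ⊤ := by
      refine Submodule.eq_top_of_finrank_eq ?_
      have := hind.rank_matrix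
      rw [Matrix.rank] at this
      rw [this, Module.finrank_fintype_fun_eq_card]
    exact LinearMap.range_eq_top.mp h1
  obtain ⟨B, hB⟩ := Matrix.mulVec_surjective_iff_exists_right_inverse.mp hsurj
  -- A constant right inverse `C` of the matrix at `x`, corrected by an adjugate.
  let C : Matrix (Fin (r + 1)) (Fin n) (Poly r) := B.map MvPolynomial.C
  let W := C * (Θ * C).adjugate
  refine ⟨fun j k => W k j, (Θ * C).det, fun j i => ?_, ?_⟩
  · have h1 : Θ * W = (Θ * C).det • 1 := by rw [← Matrix.mul_assoc, Matrix.mul_adjugate]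
    have h2 := congrFun (congrFun h1 i) j
    rw [Matrix.smul_apply, Matrix.one_apply, smul_eq_mul, mul_ite, mul_one, mul_zero] at h2
    simp only [eq_comm (a := j)]
    rw [← h2, dotProduct_comm]
    rfl
  · have h1 : (Θ * C).map ev = 1 := by
      rw [Matrix.map_mul, ← hB]
      congr 1
      ext i j
      simp [C, ev]
    have h2 : ev (Θ * C).det = ((Θ * C).map ev).det := RingHom.map_det ev _
    rw [h1, Matrix.det_one] at h2
    exact h2

theorem hasDepthThree_of_le_codim_sing {θ : Fin n → Fin (r + 1) → Poly r}
    (h : 3 ≤ codim (sing (wedge n θ))) : HasDepthThree θ := by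
  refine exists_isRegularTriple (dualIdeal θ) _ (fun x hx => ?_) h
  by_contra h0
  obtain ⟨w, D, hw, hD⟩ := exists_isDualFamily_of_evalAt_ne_zero h0
  have := hx _ (Ideal.subset_span ⟨w, D, hw, rfl⟩)
  rw [map_pow, hD, one_pow] at this
  exact one_ne_zero this

end Evaluation

/-! ### Relatively closed forms -/

section Relative

variable {r n : ℕ} {F : Fin n → Poly r} {d : Fin n → ℕ}

theorem HasDepthThree.wedge_mul_eq_zero_of_sum {θ : Fin n → Fin (r + 1) → Poly r}
    (h : HasDepthThree θ) {ζ : Fin n → Form r} (h0 : ∑ j, oneForm (θ j) * ζ j = 0) (k : Fin n) :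
    wedge n θ * ζ k = 0 := by
  obtain ⟨w, D, hw, hD⟩ := h.exists_dual
  obtain ⟨n, rfl⟩ : ∃ m, n = m + 1 := ⟨n - 1, by have := k.pos; omega⟩
  set W := contract (w k) (wedge (n + 1) θ)
  have hW : W ∈ formsOf ⊤ n :=
    contract_mem_formsOf _ (wedge_mem_formsOf fun _ => Submodule.mem_top)
  have h1 : ∀ j, oneForm (θ j) * W = (if k = j then D else 0) • wedge (n + 1) θ := fun j => by
    have := congrArg (contract (w k)) (oneForm_mul_wedge_self θ j)
    rw [contract_oneForm_mul, map_zero, hw k j, sub_eq_zero] at this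
    exact this.symm
  have h2 : ∑ j, oneForm (θ j) * W * ζ j = 0 := by
    have : ∀ j, oneForm (θ j) * W * ζ j = (-1 : ℂ) ^ n • (W * (oneForm (θ j) * ζ j)) := fun j => by
      rw [oneForm_mul_comm_of_mem hW, smul_mul_assoc, mul_assoc]
    simp only [this]
    rw [← Finset.smul_sum, ← Finset.mul_sum, h0, mul_zero, smul_zero]
  rw [Finset.sum_eq_single k] at h2
  · rw [h1, if_pos rfl, smul_mul_assoc] at h2
    exact form_smul_eq_zero hD h2
  · intro j _ hj
    rw [h1, if_neg hj.symm, zero_smul, zero_mul]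
  · simp

theorem homForms_eq_zero {q m : ℕ} (hm : m < q) {ζ : Form r} (hζ : ζ ∈ homForms r q m) : ζ = 0 := by
  refine Submodule.span_induction ?_ rfl (fun a b _ _ ha hb => by rw [ha, hb, add_zero])
    (fun c a _ ha => by rw [ha, smul_zero]) hζ
  rintro _ ⟨e, f, α, he, -⟩
  omega

theorem oneForm_grad_mem {e : ℕ} {f : Poly r} (hf : f ∈ S r e) :
    oneForm (grad f) ∈ homForms r 1 e := by
  rw [← dPoly_eq_oneForm]
  exact dPoly_mem hf

/-- A homogeneous closed form relative to `F` has a homogeneous relative division. -/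
theorem exists_homogeneous_division (hθ : HasDepthThree fun i => grad (F i))
    (hF : ∀ i, F i ∈ S r (d i)) (hd : ∀ i, 0 < d i) {k : ℕ} {α : Fin (r + 1) → Poly r}
    (hα : ∀ i, α i ∈ S r k) (h : wedge n (fun i => grad (F i)) * extD (oneForm α) = 0) :
    ∃ γ : Fin n → Fin (r + 1) → Poly r,
      extD (oneForm α) = ∑ j, oneForm (grad (F j)) * oneForm (γ j) ∧
      ∀ j, if d j ≤ k then ∀ i, γ j i ∈ S r (k - d j) else γ j = 0 := by
  have hmem : extD (oneForm α) ∈ homForms r 2 (k + 1) := extD_mem_homForms (oneForm_mem_homForms hα)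
  obtain ⟨β, hβ⟩ := hθ.exists_of_wedge_mul_twoForm (homForms_le_formsOf hmem) h
  refine ⟨fun j => if d j ≤ k then
    fun i => MvPolynomial.homogeneousComponent (k - d j) (β j i) else 0, ?_, fun j => ?_⟩
  · rcases k with _ | k
    · rw [homForms_eq_zero (by omega) hmem, eq_comm]
      refine Finset.sum_eq_zero fun j _ => ?_
      dsimp only
      rw [if_neg (by have := hd j; omega), map_zero, mul_zero]
    · rw [← coeffComponent_self (e := k) hmem, hβ, map_sum]
      refine Finset.sum_congr rfl fun j _ => ?_
      have hj : oneForm (grad (F j)) ∈ homForms r 1 ((d j - 1) + 1) := by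
        rw [Nat.sub_add_cancel (hd j)]
        exact oneForm_grad_mem (hF j)
      dsimp only
      split_ifs with hk
      · have hkd : k = (d j - 1) + (k + 1 - d j) := by have := hd j; omega
        conv_lhs => rw [hkd]
        rw [coeffComponent_mul hj, coeffComponent_oneForm]
      · rw [coeffComponent_mul_eq_zero hj _ (by omega), map_zero, mul_zero]
  · dsimp only
    split_ifs with hk
    · exact fun i => MvPolynomial.homogeneousComponent_isHomogeneous _ _
    · rfl

theorem iR_oneForm_mul_oneForm (a b : Fin (r + 1) → Poly r) :
    iR (oneForm a * oneForm b) =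
      oneForm ((MvPolynomial.X ⬝ᵥ a : Poly r) • b - (MvPolynomial.X ⬝ᵥ b : Poly r) • a) := by
  rw [iR_eq_contract, contract_oneForm_mul, contract_oneForm, mul_smul_comm, mul_one, map_sub,
    map_smul, map_smul]

/-- Relative Poincaré lemma for homogeneous `1`-forms: if `dα` vanishes on the fibres of
`F = (F_j)`, then `α` is exact on the fibres. By induction on the degree: `dα = ∑ j, dF_j ∧ γ_j`
where the `γ_j` are relatively closed of lower degree, and Cartan's formula for the Euler field
expresses `α` by `d(i_R α)` and the products `F_j γ_j`. -/
theorem relative_poincare (hθ : HasDepthThree fun i => grad (F i))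
    (hF : ∀ i, F i ∈ S r (d i)) (hd : ∀ i, 0 < d i) (k : ℕ) (α : Fin (r + 1) → Poly r)
    (hα : ∀ i, α i ∈ S r k) (h : wedge n (fun i => grad (F i)) * extD (oneForm α) = 0) :
    ∃ G ∈ S r (k + 1), ∃ c, α = grad G + combination (fun i => grad (F i)) c := by
  induction k using Nat.strong_induction_on generalizing α with
  | _ k ih =>
  obtain ⟨γ, hγ, hγS⟩ := exists_homogeneous_division hθ hF hd hα h
  -- Differentiating `dα = ∑ j, dF_j ∧ γ_j` gives `∑ j, dF_j ∧ dγ_j = 0`.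
  have hclosed : ∀ j, wedge n (fun i => grad (F i)) * extD (oneForm (γ j)) = 0 := by
    refine hθ.wedge_mul_eq_zero_of_sum ?_
    have h1 := extD_extD (oneForm α)
    rw [hγ, map_sum] at h1
    simp only [extD_oneForm_grad_mul, Finset.sum_neg_distrib, neg_eq_zero] at h1
    exact h1
  have hprim : ∀ j, ∃ g, F j * g ∈ S r (k + 1) ∧
      ∃ c, γ j = grad g + combination (fun i => grad (F i)) c := fun j => by
    have h1 := hγS j
    split_ifs at h1 with hk
    · obtain ⟨g, hg, c, hc⟩ := ih (k - d j) (by have := hd j; omega) (γ j) h1 (hclosed j)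
      refine ⟨g, ?_, c, hc⟩
      have := MvPolynomial.IsHomogeneous.mul (hF j) hg
      rwa [show d j + (k - d j + 1) = k + 1 by omega] at this
    · exact ⟨0, by rw [mul_zero]; exact zero_mem _, 0, by rw [h1, map_zero, map_zero, add_zero]⟩
  choose g hg c hc using hprim
  let N := LinearMap.range (combination fun i => grad (F i))
  have hN : ∀ j, grad (F j) ∈ N := fun j => ⟨Pi.single j 1, by simp [combination]⟩
  set G : Poly r := MvPolynomial.X ⬝ᵥ α + ∑ j, (d j : ℂ) • (F j * g j)
  have hG : G ∈ S r (k + 1) := by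
    refine add_mem (sum_mem fun i _ => ?_) (sum_mem fun j _ => Submodule.smul_mem _ _ (hg j))
    rw [add_comm k 1]
    exact MvPolynomial.IsHomogeneous.mul (MvPolynomial.isHomogeneous_X ℂ i) (hα i)
  have hcartan : ((k + 1 : ℕ) : ℂ) • α = grad (MvPolynomial.X ⬝ᵥ α : Poly r) +
      ∑ j, (((d j : ℂ) • F j) • γ j - (MvPolynomial.X ⬝ᵥ γ j : Poly r) • grad (F j)) := by
    refine oneForm_injective ?_
    rw [LinearMap.map_smul_of_tower, ← iR_extD_add_extD_iR (oneForm_mem_homForms hα), hγ, map_sum,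
      iR_eq_contract (oneForm α), contract_oneForm, extD_smul_one, map_add, map_sum, add_comm]
    congr 1
    exact Finset.sum_congr rfl fun j _ => by
      rw [iR_oneForm_mul_oneForm, X_dotProduct_grad (hF j)]
  have hmod : ((k + 1 : ℕ) : ℂ) • α - grad G ∈ N := by
    rw [hcartan, map_add, map_sum, add_sub_add_left_eq_sub, ← Finset.sum_sub_distrib]
    refine sum_mem fun j _ => ?_
    have h1 : ((d j : ℂ) • F j) • γ j - (MvPolynomial.X ⬝ᵥ γ j : Poly r) • grad (F j) -
        grad ((d j : ℂ) • (F j * g j)) =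
        ((d j : ℂ) • F j) • combination (fun i => grad (F i)) (c j) -
          (MvPolynomial.X ⬝ᵥ γ j : Poly r) • grad (F j) - ((d j : ℂ) • g j) • grad (F j) := by
      rw [map_smul, grad_mul, hc j, smul_add, smul_add, smul_assoc, smul_assoc, smul_assoc]
      abel
    rw [h1]
    exact sub_mem (sub_mem (N.smul_mem _ ⟨_, rfl⟩) (N.smul_mem _ (hN j))) (N.smul_mem _ (hN j))
  have hk : ((k + 1 : ℕ) : ℂ) ≠ 0 := Nat.cast_ne_zero.mpr (Nat.succ_ne_zero k)
  obtain ⟨b, hb⟩ := N.smul_of_tower_mem ((k + 1 : ℕ) : ℂ)⁻¹ hmod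
  refine ⟨((k + 1 : ℕ) : ℂ)⁻¹ • G, Submodule.smul_mem _ _ hG, b, ?_⟩
  rw [hb, smul_sub, smul_smul, inv_mul_cancel₀ hk, one_smul, map_smul, add_sub_cancel]

end Relative

/-! ### Rational forms satisfy the equations of foliations -/

section Equations

variable {r n : ℕ}

theorem contractVec_eq_sum (v : Vec r) : (contractVec v : ConstForm r →ₗ[ℂ] ConstForm r) =
    ∑ i, v i • contractVec (Pi.single i 1) := by
  conv_lhs => rw [pi_eq_sum_univ' v]
  simp only [map_sum, map_smul]

theorem contractConst_eq_contract (v : Vec r) (ζ : Form r) :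
    contractConst v ζ = contract (fun i => MvPolynomial.C (v i)) ζ := by
  induction ζ using Form.induction with
  | zero => simp
  | mk f α =>
    rw [contract_apply, contractConst_mk, contractVec_eq_sum, LinearMap.sum_apply, map_sum]
    refine Finset.sum_congr rfl fun i _ => ?_
    rw [contractConst_mk, LinearMap.smul_apply, map_smul]
    exact (algebraMap_smul (Poly r) (v i) _).symm
  | add a b ha hb => rw [map_add, map_add, ha, hb]

theorem interiorProd_one (ζ : Form r) : interiorProd 1 ζ = ζ := by
  induction ζ using Form.induction with
  | zero => simp
  | mk f α => simp [interiorProd, Form.map_mk]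
  | add a b ha hb => rw [map_add, ha, hb]

theorem interiorProd_ι_mul (u : Vec r) (v : ExteriorAlgebra ℂ (Vec r)) (ζ : Form r) :
    interiorProd (ExteriorAlgebra.ι ℂ u * v) ζ = contractConst u (interiorProd v ζ) := by
  induction ζ using Form.induction with
  | zero => simp
  | mk f α => simp [interiorProd, Form.map_mk, contractConst_mk, contractMulti]
  | add a b ha hb => simp only [map_add, ha, hb]

theorem interiorProd_add (v v' : ExteriorAlgebra ℂ (Vec r)) (ζ : Form r) :
    interiorProd (v + v') ζ = interiorProd v ζ + interiorProd v' ζ := by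
  induction ζ using Form.induction with
  | zero => simp
  | mk f α => simp [interiorProd, Form.map_mk]
  | add a b ha hb => rw [map_add, ha, hb, map_add, map_add]; abel

theorem interiorProd_algebraMap (c : ℂ) (ζ : Form r) :
    interiorProd (algebraMap ℂ _ c) ζ = c • ζ := by
  induction ζ using Form.induction with
  | zero => simp
  | mk f α => simp [interiorProd, Form.map_mk, Module.algebraMap_end_apply]
  | add a b ha hb => rw [map_add, ha, hb, smul_add]

/-- Induction for multivectors acting by interior products. -/
theorem interiorProd_induction {ζ : Form r} {C : ℕ → Form r → Prop}
    (smul : ∀ c : ℂ, C 0 (c • ζ)) (add : ∀ p ξ ξ', C p ξ → C p ξ' → C p (ξ + ξ'))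
    (contr : ∀ p (u : Vec r) ξ, C p ξ → C (p + 1) (contractConst u ξ)) (p : ℕ)
    (v : ExteriorAlgebra ℂ (Vec r)) (hv : v ∈ ⋀[ℂ]^p (Vec r)) : C p (interiorProd v ζ) := by
  induction p generalizing v with
  | zero =>
    rw [ExteriorAlgebra.exteriorPower, pow_zero] at hv
    obtain ⟨c, rfl⟩ := Submodule.mem_one.mp hv
    rw [interiorProd_algebraMap]
    exact smul c
  | succ p ih =>
    rw [ExteriorAlgebra.exteriorPower, pow_succ'] at hv
    refine Submodule.mul_induction_on hv ?_
      (fun a b ha hb => by rw [interiorProd_add]; exact add _ _ _ ha hb)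
    rintro _ ⟨u, rfl⟩ v hv
    rw [interiorProd_ι_mul]
    exact contr _ _ _ (ih v hv)

theorem interiorProd_mem_formsOf {U : Submodule (Poly r) (Fin (r + 1) → Poly r)} {k p : ℕ}
    {ζ : Form r} (hζ : ζ ∈ formsOf U (k + p)) {v : ExteriorAlgebra ℂ (Vec r)}
    (hv : v ∈ ⋀[ℂ]^p (Vec r)) : interiorProd v ζ ∈ formsOf U k := by
  refine interiorProd_induction
    (C := fun p' ξ => ∀ k', k' + p' = k + p → ξ ∈ formsOf U k') ?_ ?_ ?_ p v hv k rfl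
  · rintro c k' rfl
    exact Submodule.smul_of_tower_mem _ c hζ
  · exact fun _ _ _ h1 h2 k' hk => add_mem (h1 k' hk) (h2 k' hk)
  · intro p' u ξ h1 k' hk
    rw [contractConst_eq_contract]
    exact contract_mem_formsOf _ (h1 (k' + 1) (by omega))

theorem iR_interiorProd {ζ : Form r} (hζ : iR ζ = 0) {p : ℕ} {v : ExteriorAlgebra ℂ (Vec r)}
    (hv : v ∈ ⋀[ℂ]^p (Vec r)) : iR (interiorProd v ζ) = 0 := by
  refine interiorProd_induction (C := fun _ ξ => iR ξ = 0) ?_ ?_ ?_ p v hv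
  · intro c
    rw [map_smul, hζ, smul_zero]
  · intro _ ξ ξ' h1 h2
    rw [map_add, h1, h2, add_zero]
  · intro _ u ξ h1
    rw [iR_eq_contract] at h1
    rw [iR_eq_contract, contractConst_eq_contract, contract_contract, h1, map_zero, neg_zero]

theorem oneForm_mul_wedge_of_mem_span {θ : Fin n → Fin (r + 1) → Poly r}
    {a : Fin (r + 1) → Poly r} (ha : a ∈ Submodule.span (Poly r) (Set.range θ)) :
    oneForm a * wedge n θ = 0 := by
  refine Submodule.span_induction ?_ (by simp) (fun a b _ _ ha hb => ?_) (fun c a _ ha => ?_) ha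
  · rintro _ ⟨j, rfl⟩
    exact oneForm_mul_wedge_self θ j
  · rw [map_add, add_mul, ha, hb, add_zero]
  · rw [map_smul, smul_mul_assoc, ha, smul_zero]

/-- The contractions `i_v ω` of `ω = i_R (θ_0 ∧ ⋯ ∧ θ_q)` to `1`-forms are combinations of the
`θ_i` that are killed by the Euler field. -/
theorem exists_interiorProd_iR_wedge {q : ℕ} (θ : Fin (q + 2) → Fin (r + 1) → Poly r)
    {v : ExteriorAlgebra ℂ (Vec r)} (hv : v ∈ ⋀[ℂ]^q (Vec r)) :
    ∃ a ∈ Submodule.span (Poly r) (Set.range θ),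
      interiorProd v (iR (wedge (q + 2) θ)) = oneForm a ∧ (MvPolynomial.X ⬝ᵥ a : Poly r) = 0 := by
  have h1 : iR (wedge (q + 2) θ) ∈ formsOf (Submodule.span (Poly r) (Set.range θ)) (1 + q) := by
    rw [iR_eq_contract, add_comm 1 q]
    exact contract_mem_formsOf _ (wedge_mem_formsOf fun i => Submodule.subset_span ⟨i, rfl⟩)
  obtain ⟨a, ha, hae⟩ := mem_formsOf_one.mp (interiorProd_mem_formsOf h1 hv)
  refine ⟨a, ha, hae.symm, smul_one_injective ?_⟩
  rw [← contract_oneForm, ← iR_eq_contract, hae, iR_interiorProd (iR_iR _) hv]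

theorem extD_iR_wedge {F : Fin n → Poly r} {d : Fin n → ℕ} (hF : ∀ i, F i ∈ S r (d i)) :
    extD (iR (wedge n fun i => grad (F i))) =
      ((∑ i, d i : ℕ) : ℂ) • wedge n fun i => grad (F i) := by
  rw [← iR_extD_add_extD_iR (wedge_mem_homForms fun i => oneForm_grad_mem (hF i)),
    extD_wedge_grad, map_zero, zero_add]

theorem foliationEquations_iR_wedge {q : ℕ} (hq : 1 ≤ q) {F : Fin (q + 1) → Poly r}
    {d : Fin (q + 1) → ℕ} (hF : ∀ i, F i ∈ S r (d i)) :
    FoliationEquations q (iR (wedge (q + 1) fun i => grad (F i))) := by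
  obtain ⟨q, rfl⟩ : ∃ p, q = p + 1 := ⟨q - 1, by omega⟩
  intro v hv
  obtain ⟨a, ha, hae, hXa⟩ := exists_interiorProd_iR_wedge (fun i => grad (F i)) hv
  have h0 := oneForm_mul_wedge_of_mem_span ha
  rw [extD_iR_wedge hF, hae, mul_smul_comm, h0, smul_zero]
  have h1 := congrArg (contract MvPolynomial.X) h0
  rw [contract_oneForm_mul, hXa, zero_smul, zero_sub, map_zero, neg_eq_zero] at h1
  exact ⟨by rw [iR_eq_contract]; exact h1, rfl⟩

end Equations

/-! ### First-order deformations of rational forms -/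

section Deformations

variable {r n : ℕ}

/-- If the form `ω` is contracted with `p` vector fields of a dual family, then up to a factor the
result is a contraction of the product of the remaining `θ_i` with the Euler field. The module on
the right is spanned by the contractions with constant multivectors. -/
theorem IsDualFamily.smul_iR_wedge_mem {θ w : Fin n → Fin (r + 1) → Poly r} {D : Poly r}
    (hw : IsDualFamily θ w D) (p : ℕ) {m : ℕ} (hm : m + p = n) (s : Fin m → Fin n)
    (hs : Function.Injective s) :
    D ^ p • iR (wedge m fun i => θ (s i)) ∈
      Submodule.span (Poly r) ((fun v => interiorProd v (iR (wedge n θ))) '' ⋀[ℂ]^p (Vec r)) := by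
  induction p generalizing m with
  | zero =>
    obtain rfl : m = n := hm
    have hσ : wedge m (fun i => θ (s i)) =
        Equiv.Perm.sign (Equiv.ofBijective s (Finite.injective_iff_bijective.mp hs)) •
          wedge m θ := (wedge m).map_perm θ (Equiv.ofBijective s _)
    have h1 : iR (wedge m θ) ∈ Submodule.span (Poly r)
        ((fun v => interiorProd v (iR (wedge m θ))) '' ⋀[ℂ]^0 (Vec r)) :=
      Submodule.subset_span ⟨1, by rw [ExteriorAlgebra.exteriorPower, pow_zero]; exact Submodule.one_le.mp le_rfl,
        interiorProd_one _⟩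
    rw [pow_zero, one_smul, hσ]
    rcases Int.units_eq_one_or (Equiv.Perm.sign
      (Equiv.ofBijective s (Finite.injective_iff_bijective.mp hs))) with h | h
    · rw [h, one_smul]; exact h1
    · rw [h, Units.neg_smul, one_smul, map_neg]; exact neg_mem h1
  | succ p ih =>
    obtain ⟨j, hj⟩ : ∃ j, j ∉ Set.range s := by
      by_contra! h
      have := Fintype.card_le_of_surjective s fun x => h x
      simp only [Fintype.card_fin] at this
      omega
    have h1 := ih (m := m + 1) (by omega) (Fin.cons j s) (Fin.cons_injective_iff.mpr ⟨hj, hs⟩)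
    have h2 : ∀ ζ ∈ Submodule.span (Poly r)
        ((fun v => interiorProd v (iR (wedge n θ))) '' ⋀[ℂ]^p (Vec r)),
        contract (w j) ζ ∈ Submodule.span (Poly r)
          ((fun v => interiorProd v (iR (wedge n θ))) '' ⋀[ℂ]^(p + 1) (Vec r)) := by
      intro ζ hζ
      refine Submodule.span_induction ?_ (by simp) (fun a b _ _ ha hb => ?_)
        (fun c a _ ha => ?_) hζ
      · rintro _ ⟨v, hv, rfl⟩
        rw [contract_apply]
        refine sum_mem fun i _ => Submodule.smul_mem _ _ (Submodule.subset_span ?_)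
        refine ⟨ExteriorAlgebra.ι ℂ (Pi.single i 1) * v, ?_, interiorProd_ι_mul _ _ _⟩
        rw [ExteriorAlgebra.exteriorPower, pow_succ']
        exact Submodule.mul_mem_mul ⟨_, rfl⟩ hv
      · rw [map_add]; exact add_mem ha hb
      · rw [map_smul]; exact Submodule.smul_mem _ _ ha
    have h3 : contract (w j) (iR (wedge (m + 1) fun i => θ ((Fin.cons j s : Fin (m + 1) → Fin n) i)))
        = -(D • iR (wedge m fun i => θ (s i))) := by
      rw [iR_eq_contract, contract_contract, wedge_succ, contract_oneForm_mul]
      simp only [Fin.cons_zero, Fin.cons_succ]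
      rw [hw j j, if_pos rfl, contract_wedge_eq_zero, mul_zero, sub_zero, map_smul, iR_eq_contract]
      intro i
      rw [hw j (s i), if_neg fun h => hj ⟨i, h.symm⟩]
    have h4 := h2 _ h1
    rw [map_smul, h3, smul_neg, smul_smul, ← pow_succ] at h4
    exact neg_mem_iff.mp h4

/-- The second equation of the tangent space of the scheme of foliations forces `dη` to be killed
by the products `dF_a ∧ dF_b`. -/
theorem grad_mul_grad_mul_eq_zero {q : ℕ} {F : Fin (q + 2) → Poly r} {d : Fin (q + 2) → ℕ}
    (hF : ∀ i, F i ∈ S r (d i)) (hd : ∀ i, 0 < d i) (hF0 : ∀ i, F i ≠ 0)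
    (hθ : HasDepthThree fun i => grad (F i)) {η ξ : Form r} (hη : η ∈ formsOf ⊤ (q + 1))
    (h : ∀ v ∈ ⋀[ℂ]^q (Vec r),
      interiorProd v η * extD (iR (wedge (q + 2) fun i => grad (F i))) +
        interiorProd v (iR (wedge (q + 2) fun i => grad (F i))) * ξ = 0)
    {a b : Fin (q + 2)} (hab : a ≠ b) : oneForm (grad (F a)) * (oneForm (grad (F b)) * ξ) = 0 := by
  obtain ⟨w, D, hw, hD⟩ := hθ.exists_dual
  let Λ : Form r →ₗ[Poly r] Form r :=
    LinearMap.mulLeft (Poly r) (oneForm (grad (F a))) ∘ₗ LinearMap.mulRight (Poly r) ξ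
  have hΛ : Submodule.span (Poly r) ((fun v => interiorProd v
      (iR (wedge (q + 2) fun i => grad (F i)))) '' ⋀[ℂ]^q (Vec r)) ≤ LinearMap.ker Λ := by
    rw [Submodule.span_le]
    rintro _ ⟨v, hv, rfl⟩
    obtain ⟨β, -, hβ⟩ := mem_formsOf_one.mp
      (interiorProd_mem_formsOf (k := 1) (by rwa [add_comm 1 q]) hv)
    have h1 := h v hv
    rw [extD_iR_wedge hF, ← hβ] at h1
    change oneForm (grad (F a)) * (interiorProd v _ * ξ) = 0
    rw [eq_neg_of_add_eq_zero_right h1, mul_neg, mul_smul_comm, mul_smul_comm, ← mul_assoc,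
      oneForm_mul_comm, neg_mul, mul_assoc, oneForm_mul_wedge_self fun i => grad (F i), mul_zero,
      neg_zero, smul_zero, neg_zero]
  have hs : Function.Injective ![a, b] := by
    intro i j hij
    fin_cases i <;> fin_cases j <;> simp_all
  -- `θ_a ∧ ξ` is killed by all `i_v ω`, hence by `i_R (θ_a ∧ θ_b) = d_a F_a θ_b - d_b F_b θ_a`.
  have h1 := hΛ (hw.smul_iR_wedge_mem q (m := 2) (by omega) ![a, b] hs)
  have h2 : wedge 2 (fun i => grad (F (![a, b] i))) = oneForm (grad (F a)) * oneForm (grad (F b)) := by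
    rw [wedge_succ, wedge_succ, wedge_zero, mul_one]
    rfl
  rw [LinearMap.mem_ker, map_smul, h2] at h1
  have h3 := form_smul_eq_zero (pow_ne_zero q hD) h1
  rw [iR_oneForm_mul_oneForm, X_dotProduct_grad (hF a), X_dotProduct_grad (hF b), map_sub,
    map_smul, map_smul, map_sub, map_smul, map_smul] at h3
  have h4 : Λ (oneForm (grad (F a))) = 0 := by
    change oneForm (grad (F a)) * (oneForm (grad (F a)) * ξ) = 0
    rw [← mul_assoc, oneForm_mul_self, zero_mul]
  rw [h4, smul_zero, sub_zero] at h3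
  exact form_smul_eq_zero
    (smul_ne_zero (Nat.cast_ne_zero.mpr (hd a).ne') (hF0 a)) h3

theorem oneForm_mul_wedge_update (θ : Fin n → Fin (r + 1) → Poly r) (i : Fin n)
    (β : Fin (r + 1) → Poly r) :
    oneForm (θ i) * wedge n (Function.update θ i β) = -(oneForm β * wedge n θ) := by
  have h : ∀ x, oneForm x * wedge n (Function.update θ i x) = 0 := fun x => by
    have := oneForm_mul_wedge_self (Function.update θ i x) i
    rwa [Function.update_self] at this
  have h1 := h (θ i + β)
  have h2 := h (θ i)
  rw [Function.update_eq_self] at h2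
  rw [map_add, (wedge n).map_update_add, Function.update_eq_self, mul_add, add_mul, add_mul, h2,
    h β, zero_add, add_zero, add_comm] at h1
  exact eq_neg_of_add_eq_zero_left h1

theorem oneForm_mul_wedge_update_of_ne (θ : Fin n → Fin (r + 1) → Poly r) {i j : Fin n}
    (hij : j ≠ i) (β : Fin (r + 1) → Poly r) :
    oneForm (θ j) * wedge n (Function.update θ i β) = 0 := by
  have := oneForm_mul_wedge_self (Function.update θ i β) j
  rwa [Function.update_of_ne hij] at this

theorem wedge_update_grad_mem {F : Fin n → Poly r} {d : Fin n → ℕ} (hF : ∀ i, F i ∈ S r (d i))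
    {i : Fin n} {G : Poly r} (hG : G ∈ S r (d i)) :
    wedge n (Function.update (fun j => grad (F j)) i (grad G)) ∈ homForms r n (∑ i, d i) := by
  refine wedge_mem_homForms fun j => ?_
  by_cases hj : j = i
  · subst hj
    rw [Function.update_self]
    exact oneForm_grad_mem hG
  · rw [Function.update_of_ne hj]
    exact oneForm_grad_mem (hF j)

/-- A closed form killed by the products `dF_a ∧ dF_b` is a first-order variation of
`dF_0 ∧ ⋯ ∧ dF_q`. -/
theorem exists_eq_sum_wedge_update {F : Fin (n + 1) → Poly r} {d : Fin (n + 1) → ℕ}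
    (hF : ∀ i, F i ∈ S r (d i)) (hd : ∀ i, 0 < d i) (hθ : HasDepthThree fun i => grad (F i))
    {ξ : Form r} (hξ : ξ ∈ homForms r (n + 1) (∑ i, d i)) (hclosed : extD ξ = 0)
    (h : ∀ a b, a ≠ b → oneForm (grad (F a)) * (oneForm (grad (F b)) * ξ) = 0) :
    ∃ G : Fin (n + 1) → Poly r, (∀ i, G i ∈ S r (d i)) ∧
      ξ = ∑ i, wedge (n + 1) (Function.update (fun j => grad (F j)) i (grad (G i))) := by
  set θ : Fin (n + 1) → Fin (r + 1) → Poly r := fun i => grad (F i)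
  obtain ⟨E, hE⟩ : ∃ E, ∑ i, d i = E + (n + 1) := by
    refine ⟨∑ i, d i - (n + 1), (Nat.sub_add_cancel ?_).symm⟩
    calc n + 1 = ∑ _i : Fin (n + 1), 1 := by simp
      _ ≤ ∑ i, d i := Finset.sum_le_sum fun i _ => hd i
  have hwedge : wedge (n + 1) θ ∈ homForms r (n + 1) (E + (n + 1)) := by
    rw [← hE]
    exact wedge_mem_homForms fun i => oneForm_grad_mem (hF i)
  -- `dF_i ∧ ξ` is divisible by `dF_0 ∧ ⋯ ∧ dF_n`, and the quotient is relatively closed.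
  have hstep : ∀ i, ∃ G ∈ S r (d i),
      oneForm (θ i) * ξ = -(oneForm (grad G) * wedge (n + 1) θ) := by
    intro i
    have h1 : ∀ j, oneForm (θ j) * (oneForm (θ i) * ξ) = 0 := fun j => by
      by_cases hj : j = i
      · rw [hj, ← mul_assoc, oneForm_mul_self, zero_mul]
      · exact h j i hj
    obtain ⟨α, hα⟩ := hθ.exists_eq_wedge_mul_oneForm
      (oneForm_mul_mem Submodule.mem_top (homForms_le_formsOf hξ)) h1
    have hmem : oneForm (θ i) * ξ ∈ homForms r (n + 2) ((E + (d i - 1)) + (n + 2)) := by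
      have := mul_mem_homForms (oneForm_grad_mem (hF i)) hξ
      have hdi := hd i
      rwa [hE, show 1 + (n + 1) = n + 2 by omega,
        show d i + (E + (n + 1)) = (E + (d i - 1)) + (n + 2) by omega] at this
    set α' : Fin (r + 1) → Poly r :=
      fun k => MvPolynomial.homogeneousComponent (d i - 1) (α k)
    have hα' : oneForm (θ i) * ξ = wedge (n + 1) θ * oneForm α' := by
      rw [← coeffComponent_self hmem, hα, coeffComponent_mul hwedge, coeffComponent_oneForm]
    have hrel : wedge (n + 1) θ * extD (oneForm α') = 0 := by
      have h2 := congrArg extD hα'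
      rw [extD_oneForm_grad_mul, hclosed, mul_zero, neg_zero, extD_wedge_grad_mul] at h2
      exact (smul_eq_zero.mp h2.symm).resolve_left
        (pow_ne_zero _ (neg_ne_zero.mpr one_ne_zero))
    obtain ⟨G, hG, c, hc⟩ := relative_poincare hθ hF hd (d i - 1) α'
      (fun k => MvPolynomial.homogeneousComponent_isHomogeneous _ _) hrel
    rw [Nat.sub_add_cancel (hd i)] at hG
    refine ⟨(-(-1) ^ (n + 1) : ℂ) • G, Submodule.smul_mem _ _ hG, ?_⟩
    rw [hα', hc, map_add, mul_add, wedge_mul_combination, add_zero, map_smul,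
      LinearMap.map_smul_of_tower, smul_mul_assoc,
      oneForm_mul_comm_of_mem (wedge_mem_formsOf (U := ⊤) fun _ => Submodule.mem_top), smul_smul,
      neg_mul, ← mul_pow, neg_smul, neg_neg]
    simp
  choose G hGS hG using hstep
  -- After subtracting the corresponding variation, `ξ` is killed by every `dF_j`.
  set ζ := ξ - ∑ i, wedge (n + 1) (Function.update θ i (grad (G i))) with hζ
  have hζmem : ζ ∈ homForms r (n + 1) (E + (n + 1)) := by
    rw [← hE]
    exact sub_mem hξ (sum_mem fun i _ => wedge_update_grad_mem hF (hGS i))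
  have hζ0 : ∀ j, oneForm (θ j) * ζ = 0 := fun j => by
    rw [hζ, mul_sub, Finset.mul_sum, Finset.sum_eq_single j, oneForm_mul_wedge_update, hG,
      sub_self]
    · exact fun i _ hi => oneForm_mul_wedge_update_of_ne θ hi.symm _
    · simp
  obtain ⟨c, hc⟩ := hθ.exists_eq_smul_wedge (homForms_le_formsOf hζmem) hζ0
  -- The factor `c` is constant, because both sides are homogeneous of the same degree.
  have hconst : ζ = MvPolynomial.coeff 0 c • wedge (n + 1) θ := by
    have h1 : c • wedge (n + 1) θ = wedge (n + 1) θ * (c • 1) := by rw [mul_smul_comm, mul_one]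
    have h2 := coeffComponent_self hζmem
    rw [hc, h1] at h2
    have h3 := coeffComponent_mul (b := 0) hwedge (c • 1)
    rw [add_zero] at h3
    rw [h3, coeffComponent_smul_one, MvPolynomial.homogeneousComponent_zero] at h2
    rw [hc, h1, ← h2, mul_smul_comm, mul_one]
    exact algebraMap_smul (Poly r) _ _
  -- A constant multiple of `dF_0 ∧ ⋯ ∧ dF_n` is the variation that rescales `F_0`.
  refine ⟨fun i => G i + if i = 0 then MvPolynomial.coeff 0 c • F i else 0, fun i => ?_, ?_⟩
  · refine add_mem (hGS i) ?_
    split_ifs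
    · exact Submodule.smul_mem _ _ (hF i)
    · exact zero_mem _
  · have h1 : ∑ i, wedge (n + 1) (Function.update θ i
        (grad (if i = 0 then MvPolynomial.coeff 0 c • F i else 0))) = ζ := by
      rw [Finset.sum_eq_single 0, if_pos rfl, map_smul, hconst,
        ← algebraMap_smul (Poly r) (MvPolynomial.coeff 0 c) (grad (F 0)),
        (wedge (n + 1)).map_update_smul, algebraMap_smul]
      · congr 2
        exact Function.update_eq_self 0 θ
      · intro i _ hi
        rw [if_neg hi, map_zero]
        exact (wedge (n + 1)).map_update_zero _ _
      · simp
    simp only [map_add, (wedge (n + 1)).map_update_add, Finset.sum_add_distrib]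
    rw [h1, hζ]
    abel

end Deformations

/-! ### The derivative of the parametrization -/

section Parametrization

variable {r q : ℕ} {d : Fin (q + 1) → ℕ}

theorem coe_mu (F : ∀ i, S r (d i)) :
    (mu r q d F : Form r) = iR (wedge (q + 1) fun i => grad (F i : Poly r)) := by
  change iR (List.ofFn fun i => dPoly (F i : Poly r)).prod = _
  simp only [wedge_apply, dPoly_eq_oneForm]

theorem coe_mu_update (F : ∀ i, S r (d i)) (i : Fin (q + 1)) (g : S r (d i)) :
    (mu r q d (Function.update F i g) : Form r) =
      iR (wedge (q + 1) (Function.update (fun j => grad (F j : Poly r)) i (grad (g : Poly r)))) := by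
  rw [coe_mu]
  congr 2
  funext j
  by_cases hj : j = i
  · subst hj
    simp
  · simp [Function.update_of_ne hj]

theorem foliationEquations_mu (hq : 1 ≤ q) (F : ∀ i, S r (d i)) :
    FoliationEquations q (mu r q d F : Form r) := by
  rw [coe_mu]
  exact foliationEquations_iR_wedge hq fun i => (F i).2

theorem ne_zero_of_mu_ne_zero {F : ∀ i, S r (d i)} (hF : mu r q d F ≠ 0) (i : Fin (q + 1)) :
    (F i : Poly r) ≠ 0 := fun h =>
  hF ((mu r q d).map_coord_zero i (Subtype.ext h))

theorem pos_of_mu_ne_zero {F : ∀ i, S r (d i)} (hF : mu r q d F ≠ 0) (i : Fin (q + 1)) :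
    0 < d i := by
  refine Nat.pos_of_ne_zero fun h => hF (Subtype.ext ?_)
  have hc : (F i : Poly r) = MvPolynomial.C (MvPolynomial.coeff 0 (F i : Poly r)) :=
    MvPolynomial.totalDegree_eq_zero_iff_eq_C.mp
      (Nat.le_zero.mp (h ▸ MvPolynomial.IsHomogeneous.totalDegree_le (F i).2))
  have hg : grad (F i : Poly r) = 0 := by
    rw [hc]
    funext j
    rw [grad_apply, MvPolynomial.pderiv_C, Pi.zero_apply]
  rw [coe_mu, (wedge (q + 1)).map_coord_zero i hg, map_zero, Submodule.coe_zero]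

theorem hasDepthThree_of_mem_goodLocus {F : ∀ i, S r (d i)} (hF : mu r q d F ≠ 0)
    (hU : rho r q d F hF ∈ goodLocus r q d) : HasDepthThree fun i => grad (F i : Poly r) := by
  obtain ⟨a, ha⟩ := Projectivization.exists_smul_eq_mk_rep ℂ (mu r q d F) hF
  have h := hU.2.1
  have hm : ((∑ i, d i : ℕ) : ℂ) ≠ 0 := by
    rw [Nat.cast_ne_zero, Fin.sum_univ_succ]
    have := pos_of_mu_ne_zero hF 0
    omega
  have hrep : extD ((rho r q d F hF).rep : Form r) =
      ((a : ℂ) * (∑ i, d i : ℕ)) • wedge (q + 1) fun i => grad (F i : Poly r) := by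
    rw [rho, ← ha, Units.smul_def, Submodule.coe_smul, map_smul, coe_mu,
      extD_iR_wedge fun i => (F i).2, smul_smul]
  refine hasDepthThree_of_le_codim_sing ?_
  have hs : sing (extD ((rho r q d F hF).rep : Form r)) =
      sing (wedge (q + 1) fun i => grad (F i : Poly r)) := by
    ext x
    change evalAt x _ = 0 ↔ evalAt x _ = 0
    rw [hrep, map_smul, smul_eq_zero_iff_right (mul_ne_zero a.ne_zero hm)]
  rwa [hs] at h

/-- Rational forms satisfy the quadratic equations of foliations identically in the parameters, so
the polarized equations hold for the variation of a single parameter. -/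
theorem mu_update_mem_foliationTangentLift (hq : 1 ≤ q) (F : ∀ i, S r (d i)) (i : Fin (q + 1))
    (g : S r (d i)) :
    mu r q d (Function.update F i g) ∈ foliationTangentLift (mu r q d F) := by
  intro v hv
  obtain ⟨h1, h2⟩ := foliationEquations_mu hq F v hv
  obtain ⟨h3, h4⟩ := foliationEquations_mu hq (Function.update F i g) v hv
  obtain ⟨h5, h6⟩ := foliationEquations_mu hq (Function.update F i (F i + g)) v hv
  rw [(mu r q d).map_update_add, Function.update_eq_self, Submodule.coe_add] at h5 h6
  rw [map_add, add_mul, mul_add, mul_add, h1, h3, zero_add, add_zero] at h5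
  rw [map_add, map_add, add_mul, mul_add, mul_add, h2, h4, zero_add, add_zero] at h6
  exact ⟨by rw [add_comm, h5], by rw [add_comm, h6]⟩

theorem linearDeriv_mu_mem_foliationTangentLift (hq : 1 ≤ q) (F g : ∀ i, S r (d i)) :
    (mu r q d).linearDeriv F g ∈ foliationTangentLift (mu r q d F) := by
  rw [MultilinearMap.linearDeriv_apply]
  exact sum_mem fun i _ => mu_update_mem_foliationTangentLift hq F i (g i)

theorem dRho_mk (F g : ∀ i, S r (d i)) :
    dRho r q d F (fun i => (Submodule.span ℂ {F i}).mkQ (g i)) =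
      (Submodule.span ℂ {mu r q d F}).mkQ ((mu r q d).linearDeriv F g) := by
  have h : (Submodule.quotientPi fun i => Submodule.span ℂ {F i}).symm
      (fun i => (Submodule.span ℂ {F i}).mkQ (g i)) = Submodule.Quotient.mk g :=
    (LinearEquiv.symm_apply_eq _).mpr rfl
  rw [dRho, LinearMap.comp_apply, LinearEquiv.coe_coe, h]
  rfl

theorem dRho_mem_foliationTangent (hq : 1 ≤ q) (F : ∀ i, S r (d i))
    (G : ∀ i, S r (d i) ⧸ Submodule.span ℂ {F i}) :
    dRho r q d F G ∈ foliationTangent (mu r q d F) := by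
  choose g hg using fun i => (Submodule.span ℂ {F i}).mkQ_surjective (G i)
  obtain rfl : (fun i => (Submodule.span ℂ {F i}).mkQ (g i)) = G := funext hg
  rw [dRho_mk]
  exact Submodule.mem_map_of_mem (linearDeriv_mu_mem_foliationTangentLift hq F g)

/-- At a point of the good locus, every first-order deformation of the foliation is a first-order
deformation of the parameters `F_0, …, F_q`. -/
theorem exists_linearDeriv_mu_eq (hq : 1 ≤ q) {F : ∀ i, S r (d i)} (hF : mu r q d F ≠ 0)
    (hU : rho r q d F hF ∈ goodLocus r q d) {η : twistedForms r q (∑ i, d i)}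
    (hη : η ∈ foliationTangentLift (mu r q d F)) : ∃ g, (mu r q d).linearDeriv F g = η := by
  obtain ⟨q, rfl⟩ : ∃ n, q = n + 1 := ⟨q - 1, by omega⟩
  have hS : ∀ i, (F i : Poly r) ∈ S r (d i) := fun i => (F i).2
  have hθ := hasDepthThree_of_mem_goodLocus hF hU
  have hd := pos_of_mu_ne_zero hF
  obtain ⟨hηm, hηR⟩ := η.2
  obtain ⟨G, hGS, hG⟩ := exists_eq_sum_wedge_update hS hd hθ (extD_mem_homForms hηm) (extD_extD _)
    fun a b hab => grad_mul_grad_mul_eq_zero hS hd (ne_zero_of_mu_ne_zero hF) hθ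
      (homForms_le_formsOf hηm) (fun v hv => by
        rw [← coe_mu]
        exact (hη v hv).2) hab
  have hm : ((∑ i, d i : ℕ) : ℂ) ≠ 0 := by
    rw [Nat.cast_ne_zero, Fin.sum_univ_succ]
    have := hd 0
    omega
  have hcartan := iR_extD_add_extD_iR hηm
  rw [LinearMap.mem_ker.mp hηR, map_zero, add_zero, hG, map_sum] at hcartan
  have h1 : (mu r (q + 1) d).linearDeriv F (fun i => ⟨G i, hGS i⟩) =
      ((∑ i, d i : ℕ) : ℂ) • η := by
    refine Subtype.ext ?_
    rw [Submodule.coe_smul, ← hcartan, MultilinearMap.linearDeriv_apply,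
      AddSubmonoidClass.coe_finsetSum]
    exact Finset.sum_congr rfl fun i _ => coe_mu_update F i _
  refine ⟨((∑ i, d i : ℕ) : ℂ)⁻¹ • fun i => ⟨G i, hGS i⟩, ?_⟩
  rw [map_smul, h1, inv_smul_smul₀ hm]

end Parametrization

end RationalFoliation

end

open RationalFoliation in
theorem propositionP (r q : ℕ) (hr : 3 ≤ r) (hq : 1 ≤ q) (hqr : q < r - 1)
    (d : Fin (q + 1) → ℕ) (F : ∀ i, S r (d i)) (hF : mu r q d F ≠ 0)
    (hU : rho r q d F hF ∈ goodLocus r q d) :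
    ∃ h : ∀ G, dRho r q d F G ∈ foliationTangent (mu r q d F),
      Function.Surjective ((dRho r q d F).codRestrict (foliationTangent (mu r q d F)) h) := by
  refine ⟨dRho_mem_foliationTangent hq F, ?_⟩
  rintro ⟨_, η, hη, rfl⟩
  obtain ⟨g, rfl⟩ := exists_linearDeriv_mu_eq hq hF hU hη
  exact ⟨fun i => (Submodule.span ℂ {F i}).mkQ (g i), Subtype.ext (dRho_mk F g)⟩
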